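/- Let $U=(U_n)_{n\ge 0}$ be a positional numeration system, i.e., a strictly increasing sequence of integers with $U_0=1$ and $\sup_{n\ge0} U_{n+1}/U_n<\infty$. For $x\in\mathbb N$, let $\mathrm{rep}_U(x)=a_{\ell-1}\cdots a_0$ be its greedy representation: $\ell$ is the least integer with $x<U_\ell$, $r_\ell=x$, and $a_n=\lfloor r_{n+1}/U_n\rfloor$, $r_n=r_{n+1}-a_nU_n$ for $n=\ell-1,\ldots,0$. The numeration language of $U$ is $L_U=0^*\,\mathrm{rep}_U(\mathbb N)$, a language over the alphabet $\{0,\ldots,\sup_{n\ge 0}\lceil U_{n+1}/U_n\rceil-1\}$. An alternate base is a tuple $B=(\beta_0,\ldots,\beta_{p-1})$, $p\ge 1$, of real numbers $\beta_i\ge 1$, extended by $\beta_n=\beta_{n\bmod p}$. It is the alternate base associated with $U$ if $\beta_i=\lim_{n\to\infty}U_{np-i}/U_{np-i-1}$ for all $i\in\{0,\ldots,p-1\}$ and $p$ is the minimal positive integer for which these $p$ limits exist. For $i\ge 0$, let $\mathbf d_i=t_{i,0}t_{i,1}\cdots$ be the greedy expansion of $1$ in the shifted base $(\beta_i,\ldots,\beta_{i+p-1})$: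 $r_0=1$, and $t_{i,n}=\lfloor\beta_{i+n}r_n\rfloor$, $r_{n+1}=\beta_{i+n}r_n-t_{i,n}$ for $n\ge 0$. The quasi-greedy expansions $\mathbf d_i^*$ of $1$ are defined recursively: $\mathbf d_i^*=\mathbf d_i$ if $\mathbf d_i$ does not end in a tail of zeros, and $\mathbf d_i^*=t_{i,0}\cdots t_{i,\ell-2}(t_{i,\ell-1}-1)\,\mathbf d_{i+\ell}^*$ if $\mathbf d_i=t_{i,0}\cdots t_{i,\ell-1}0^\omega$ with $t_{i,\ell-1}>0$. The base $B$ is called Parry if $\mathbf d_i^*$ is ultimately periodic for every $i\in\{0,\ldots,p-1\}$. **Proposition.** If the numeration language $L_U$ is regular, then $U$ has an associated alternate base, which is unique, and this associated alternate base is Parry. -/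

import Mathlib

open Filter Topology

noncomputable section

/-- A positional numeration system: an increasing sequence of integers starting at `1`,
with uniformly bounded quotients of consecutive terms. -/
structure PositionalSystem where
  U : ℕ → ℕ
  zero_eq_one : U 0 = 1
  increasing : StrictMono U
  bounded_quotients : ∃ C : ℝ, ∀ n, (U (n + 1) : ℝ) / (U n : ℝ) ≤ C

namespace PositionalSystem

/-- The digits `a_{ℓ-1} ⋯ a_0` (most significant first) produced by the greedy algorithm
started at index `ℓ` with remainder `r`: at each step `a_n = ⌊r / U_n⌋` and the new remainder is
`r - a_n U_n = r % U_n`. -/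
def greedyDigits (S : PositionalSystem) : ℕ → ℕ → List ℕ
  | 0, _ => []
  | n + 1, r => (r / S.U n) :: S.greedyDigits n (r % S.U n)

/-- The least `ℓ` such that `x < U_ℓ`; it exists since `U` is increasing. -/
def repLength (S : PositionalSystem) (x : ℕ) : ℕ := sInf {l : ℕ | x < S.U l}

/-- The greedy representation of `x`. -/
def rep (S : PositionalSystem) (x : ℕ) : List ℕ := S.greedyDigits (S.repLength x) x

/-- The number of letters of the numeration alphabet, `sup_n ⌈U_{n+1} / U_n⌉`
(the supremum is finite because the quotients are bounded). -/
def alphabetSize (S : PositionalSystem) : ℕ :=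
  ⨆ n : ℕ, ⌈(S.U (n + 1) : ℝ) / (S.U n : ℝ)⌉₊

/-- The numeration alphabet `{0, …, sup_n ⌈U_{n+1} / U_n⌉ - 1}`. -/
abbrev Alphabet (S : PositionalSystem) : Type := Fin S.alphabetSize

/-- The numeration language `0^* rep(ℕ)`, over the numeration alphabet. -/
def numerationLanguage (S : PositionalSystem) : Language S.Alphabet :=
  {w | ∃ k x : ℕ, w.map Fin.val = List.replicate k 0 ++ S.rep x}

end PositionalSystem

/-- An infinite word over `ℕ` is finite, as a representation, if it ends in a tail of zeros. -/
def EndsInZeros (a : ℕ → ℕ) : Prop := ∃ N, ∀ n, N ≤ n → a n = 0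

/-- For a word ending in a tail of zeros: the length of its prefix up to the last nonzero digit. -/
def wordLength (a : ℕ → ℕ) : ℕ := sInf {l : ℕ | ∀ n, l ≤ n → a n = 0}

/-- An infinite word is ultimately periodic. -/
def UltimatelyPeriodic (a : ℕ → ℕ) : Prop :=
  ∃ q m : ℕ, 0 < m ∧ ∀ n, q ≤ n → a (n + m) = a n

/-- The remainders `r_0 = x`, `r_{n+1} = β_n r_n - ⌊β_n r_n⌋` of the greedy algorithm. -/
def greedyRemainder (β : ℕ → ℝ) (x : ℝ) : ℕ → ℝ
  | 0 => x
  | n + 1 => Int.fract (β n * greedyRemainder β x n)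

/-- The greedy digits `a_n = ⌊β_n r_n⌋`, for `x ∈ [0, 1]`. -/
def greedyExpansion (β : ℕ → ℝ) (x : ℝ) (n : ℕ) : ℕ := ⌊β n * greedyRemainder β x n⌋₊

/-- An alternate real base `(β_0, …, β_{p-1})`, a nonempty tuple of reals `≥ 1`. -/
structure AlternateBase where
  p : ℕ
  p_pos : 0 < p
  β : Fin p → ℝ
  one_le : ∀ i, 1 ≤ β i

namespace AlternateBase

/-- The periodic extension `β_n = β_{n mod p}`. -/
def seq (B : AlternateBase) (n : ℕ) : ℝ := B.β ⟨n % B.p, Nat.mod_lt n B.p_pos⟩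

/-- The greedy expansion `d_i` of `1` in the `i`-th circular shift `(β_i, …, β_{i+p-1})` of `B`
(the index `i` being read modulo `p`). For the degenerate base `(1)`, the
algorithm started at `1` gives `1 0 0 ⋯`, which is the conventional value. -/
def d (B : AlternateBase) (i : ℕ) : ℕ → ℕ := greedyExpansion (fun n => B.seq (i + n)) 1

/-- The length of `d_i`, used when `d_i` is finite. -/
def len (B : AlternateBase) (i : ℕ) : ℕ := wordLength (B.d i)

theorem d_zero_pos (B : AlternateBase) (i : ℕ) : 0 < B.d i 0 := by
  have h : (1 : ℝ) ≤ B.seq (i + 0) := B.one_le _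
  simp only [d, greedyExpansion, greedyRemainder, mul_one]
  exact Nat.floor_pos.mpr h

theorem len_pos (B : AlternateBase) (i : ℕ) (h : EndsInZeros (B.d i)) : 0 < B.len i := by
  rw [Nat.pos_iff_ne_zero]
  intro h0
  have hmem : wordLength (B.d i) ∈ {l : ℕ | ∀ n, l ≤ n → B.d i n = 0} := Nat.sInf_mem h
  have h0' : wordLength (B.d i) = 0 := h0
  rw [h0'] at hmem
  exact (B.d_zero_pos i).ne' (hmem 0 le_rfl)

open Classical in
/-- The `n`-th digit of the quasi-greedy expansion `d_i^*` of `1`: if `d_i` is infinite then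
`d_i^* = d_i`; if `d_i = t_0 ⋯ t_{ℓ-1} 0^ω` with `t_{ℓ-1} > 0`, then
`d_i^* = t_0 ⋯ t_{ℓ-2} (t_{ℓ-1} - 1) d_{i+ℓ}^*`. -/
def quasiGreedy (B : AlternateBase) (i n : ℕ) : ℕ :=
  if h : EndsInZeros (B.d i) then
    if n + 1 < B.len i then B.d i n
    else if n + 1 = B.len i then B.d i n - 1
    else
      have : 0 < B.len i := B.len_pos i h
      B.quasiGreedy (i + B.len i) (n - B.len i)
  else B.d i n
termination_by n
decreasing_by omega

/-- `B` is Parry if `d_i^*` is ultimately periodic for every `i ∈ {0, …, p-1}`. -/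
def IsParry (B : AlternateBase) : Prop :=
  ∀ i < B.p, UltimatelyPeriodic (B.quasiGreedy i)

end AlternateBase

namespace PositionalSystem

/-- `β_i = lim_n U_{np-i} / U_{np-i-1}` for all `0 ≤ i < p`. All indices are nonnegative once
`n ≥ 1`; the term `n = 0` does not affect the limit. -/
def HasAssociatedBase (S : PositionalSystem) (B : AlternateBase) : Prop :=
  ∀ i : Fin B.p,
    Tendsto (fun n : ℕ => (S.U (n * B.p - i) : ℝ) / (S.U (n * B.p - i - 1) : ℝ)) atTop (𝓝 (B.β i))

/-- `B` is *the* alternate base associated with the system: the one of minimal length `p`. -/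
def IsTheAssociatedBase (S : PositionalSystem) (B : AlternateBase) : Prop :=
  S.HasAssociatedBase B ∧ ∀ B' : AlternateBase, S.HasAssociatedBase B' → B.p ≤ B'.p

end PositionalSystem

end

/-! Existence of the limits. An automaton for the language makes `U_n` the number of accepted words
of length `n`, hence a sum of entries of the `n`-th power of a nonnegative matrix
(`Recognizes.sum_transitionMatrix_pow`). The point is that `U_n` has exact order `l ^ n`. Cutting
accepted paths gives `U_{m+n} ≤ C U_m U_n`. For the converse, the word of `U_n - 1` is the
lexicographically greatest of its length, so each digit is dictated by the current state and the set
of states live for the remaining length (`Recognizes.isGreatest_maxDigit`). Live sets are eventually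
periodic, so leading digits are periodic in `n` and `U` obeys, up to a bounded error, a recurrence
with periodic coefficients. This yields `U_m U_n ≤ C U_{m+n}`, unless outside a bounded tail these
words have digit sum at most 1; then the quotients tend to 1. With exact growth, the trimmed matrix
divided by `l` is power-bounded, and the powers of such a nonnegative matrix converge along an
arithmetic progression (`Matrix.exists_tendsto_pow_mul`), so the quotients converge along it too.

Parry property. If `d_i` is infinite, its digits are the limits of those of `U_{np-i} - 1`, and a
repeated automaton state makes them ultimately periodic. The quasi-greedy expansions are
concatenations of blocks governed by residues mod `p`, so they inherit periodicity. -/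

/-! ### Powers of power-bounded nonnegative matrices -/

section NonnegMatrix

variable {Q : Type*} [Fintype Q]

theorem Matrix.mul_apply_ne_zero_iff_of_nonneg {X Y : Matrix Q Q ℝ} (hX : ∀ i j, 0 ≤ X i j)
    (hY : ∀ i j, 0 ≤ Y i j) (i j : Q) :
    (X * Y) i j ≠ 0 ↔ ∃ a, X i a ≠ 0 ∧ Y a j ≠ 0 := by
  rw [Matrix.mul_apply, Ne, Finset.sum_eq_zero_iff_of_nonneg
    (fun a _ => mul_nonneg (hX i a) (hY a j))]
  simp [not_or]

theorem Matrix.mul_apply_nonneg {X Y : Matrix Q Q ℝ} (hX : ∀ i j, 0 ≤ X i j)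
    (hY : ∀ i j, 0 ≤ Y i j) (i j : Q) : 0 ≤ (X * Y) i j := by
  rw [Matrix.mul_apply]
  exact Finset.sum_nonneg fun a _ => mul_nonneg (hX i a) (hY a j)

/-- Two matrices have the same support. -/
def Matrix.SameSupport (X Y : Matrix Q Q ℝ) : Prop := ∀ i j, X i j ≠ 0 ↔ Y i j ≠ 0

theorem Matrix.SameSupport.mul {X X' Y Y' : Matrix Q Q ℝ} (hX : ∀ i j, 0 ≤ X i j)
    (hX' : ∀ i j, 0 ≤ X' i j) (hY : ∀ i j, 0 ≤ Y i j) (hY' : ∀ i j, 0 ≤ Y' i j)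
    (h : X.SameSupport X') (h' : Y.SameSupport Y') : (X * Y).SameSupport (X' * Y') := by
  intro i j
  rw [Matrix.mul_apply_ne_zero_iff_of_nonneg hX hY, Matrix.mul_apply_ne_zero_iff_of_nonneg hX' hY']
  simp only [h _ _, h' _ _]

variable [DecidableEq Q]

/-- In a group of nonnegative matrices with bounded powers, an element with the support of the
identity `e` is the identity. -/
theorem Matrix.eq_of_sameSupport {e h h' : Matrix Q Q ℝ} {M : ℝ} (he0 : ∀ i j, 0 ≤ e i j)
    (hh0 : ∀ i j, 0 ≤ h i j) (hh'0 : ∀ i j, 0 ≤ h' i j) (hM : ∀ n i j, (h ^ n) i j ≤ M)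
    (hM' : ∀ n i j, (h' ^ n) i j ≤ M) (hee : e * e = e) (hh'h : h' * h = e) (hhe : h * e = h)
    (heh : e * h = h) (hh'e : h' * e = h') (hs : h.SameSupport e) : h = e := by
  by_cases hz : ∃ i j, e i j ≠ 0
  swap
  · push Not at hz
    have : e = 0 := by ext i j; exact hz i j
    rw [← hhe, this, mul_zero]
  have hs' : h'.SameSupport e := by
    have := Matrix.SameSupport.mul hh'0 hh'0 hh0 he0 (fun _ _ => Iff.rfl) hs
    rw [hh'h, hh'e] at this
    exact fun i j => (this i j).symm
  obtain ⟨i₀, j₀, hij₀⟩ := hz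
  obtain ⟨⟨i, j⟩, hij, hmin⟩ := Finset.exists_min_image
    (Finset.univ.filter fun x : Q × Q => e x.1 x.2 ≠ 0) (fun x => h x.1 x.2 / e x.1 x.2)
    ⟨(i₀, j₀), by simpa using hij₀⟩
  simp only [Finset.mem_filter, Finset.mem_univ, true_and] at hij hmin
  -- `δ` is the largest constant with `δ e ≤ h` entrywise; the difference vanishes at `(i, j)`,
  -- where `e` does not.
  set δ := h i j / e i j with hδ
  have hδ0 : 0 ≤ δ := div_nonneg (hh0 _ _) (he0 _ _)
  have hge : ∀ a b, δ * e a b ≤ h a b := by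
    intro a b
    by_cases hab : e a b = 0
    · rw [hab, mul_zero]; exact hh0 _ _
    · have := hmin (a, b) hab
      rwa [le_div_iff₀ (lt_of_le_of_ne (he0 _ _) (Ne.symm hab))] at this
  have hR0 : ∀ a b, 0 ≤ (h - δ • e) a b := by
    intro a b
    simp only [Matrix.sub_apply, Matrix.smul_apply, smul_eq_mul]
    linarith [hge a b]
  have heR : e * (h - δ • e) = h - δ • e := by
    rw [mul_sub, heh, mul_smul_comm, hee]
  have hRij : (h - δ • e) i j = 0 := by
    simp only [Matrix.sub_apply, Matrix.smul_apply, smul_eq_mul]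
    rw [hδ, div_mul_cancel₀ _ hij, sub_self]
  -- `h'` has the support of `e`, and `e` fixes `h - δ e`, so multiplying by `h'` preserves the
  -- support, in particular the zero at `(i, j)`.
  have hpow : ∀ n : ℕ, (∀ a b, 0 ≤ (h' ^ n * (h - δ • e)) a b) ∧
      (h' ^ n * (h - δ • e)).SameSupport (h - δ • e) := by
    intro n
    refine ⟨Matrix.mul_apply_nonneg (Matrix.pow_apply_nonneg hh'0 n) hR0, ?_⟩
    induction n with
    | zero => rw [pow_zero, one_mul]; exact fun _ _ => Iff.rfl
    | succ n ih =>
      have := Matrix.SameSupport.mul hh'0 he0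
        (Matrix.mul_apply_nonneg (Matrix.pow_apply_nonneg hh'0 n) hR0) hR0 hs' ih
      rwa [heR, ← mul_assoc, ← pow_succ'] at this
  have hzero : ∀ n : ℕ, (h' ^ n * (h - δ • e)) i j = 0 := by
    intro n
    by_contra hne
    exact ((hpow n).2 i j).1 hne hRij
  have hrec : ∀ n : ℕ, e i j = δ ^ (n + 1) * (h' ^ (n + 1)) i j := by
    have key : ∀ n : ℕ, (h' ^ n * e) i j = δ * (h' ^ (n + 1)) i j := by
      intro n
      have := hzero (n + 1)
      rw [mul_sub, mul_smul_comm, pow_succ, mul_assoc, mul_assoc, hh'h, hh'e, ← pow_succ] at this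
      simp only [Matrix.sub_apply, Matrix.smul_apply, smul_eq_mul] at this
      linarith
    intro n
    induction n with
    | zero => simpa using key 0
    | succ n ih =>
      have h1 := key (n + 1)
      rw [pow_succ h' n, mul_assoc, hh'e, ← pow_succ] at h1
      rw [ih, h1]
      ring
  -- The powers of `h'` are bounded, so `δ < 1` would force `e i j = 0`.
  have hδ1 : 1 ≤ δ := by
    by_contra hlt
    push Not at hlt
    have hlim : Tendsto (fun n : ℕ => δ ^ (n + 1) * M) atTop (𝓝 (0 * M)) :=
      ((tendsto_pow_atTop_nhds_zero_of_lt_one hδ0 hlt).comp (tendsto_add_atTop_nat 1)).mul_const M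
    rw [zero_mul] at hlim
    have : e i j ≤ 0 := ge_of_tendsto' hlim fun n => by
      rw [hrec n]
      exact mul_le_mul_of_nonneg_left (hM' _ _ _) (pow_nonneg hδ0 _)
    exact hij (le_antisymm this (he0 _ _))
  have hge1 : ∀ a b, 0 ≤ (h - e) a b := by
    intro a b
    rw [Matrix.sub_apply]
    nlinarith [hge a b, he0 a b]
  have hehe : e * (h - e) = h - e := by rw [mul_sub, heh, hee]
  have hdiff : ∀ n a b, (h - e) a b ≤ (h ^ (n + 1) * (h - e)) a b := by
    intro n
    induction n with
    | zero =>
      intro a b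
      have : h ^ (0 + 1) * (h - e) = (h - e) + (h - e) * (h - e) := by
        rw [zero_add, pow_one, sub_mul h e (h - e), hehe, add_sub_cancel]
      rw [this, Matrix.add_apply]
      linarith [Matrix.mul_apply_nonneg hge1 hge1 a b]
    | succ n ih =>
      intro a b
      have h1 : h ^ (n + 1 + 1) * (h - e)
          = h ^ (n + 1) * (h - e) + h ^ (n + 1) * ((h - e) * (h - e)) := by
        rw [sub_mul h e (h - e), hehe, mul_sub (h ^ (n + 1)) (h * (h - e)), ← mul_assoc, ← pow_succ,
          add_sub_cancel]
      rw [h1, Matrix.add_apply]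
      linarith [ih a b, Matrix.mul_apply_nonneg (Matrix.pow_apply_nonneg hh0 (n + 1))
        (Matrix.mul_apply_nonneg hge1 hge1) a b]
  -- Now `h ≥ e`; a positive entry of `h - e` would make the powers of `h` grow linearly.
  have hlin : ∀ (n : ℕ) a b, h a b + n * (h - e) a b ≤ (h ^ (n + 1)) a b := by
    intro n a b
    induction n with
    | zero => simp
    | succ n ih =>
      have h1 : h ^ (n + 1 + 1) = h ^ (n + 1) + h ^ (n + 1) * (h - e) := by
        rw [mul_sub, ← pow_succ, pow_succ h n, mul_assoc (h ^ n) h e, hhe, ← pow_succ,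
          add_sub_cancel]
      rw [h1, Matrix.add_apply]
      push_cast
      linarith [hdiff n a b]
  ext a b
  by_contra hne
  have hpos : 0 < (h - e) a b :=
    lt_of_le_of_ne (hge1 a b) (fun h0 => hne (by rw [Matrix.sub_apply] at h0; linarith))
  obtain ⟨n, hn⟩ := exists_nat_gt (M / (h - e) a b)
  rw [div_lt_iff₀ hpos] at hn
  linarith [hlin n a b, hM (n + 1) a b, hh0 a b]

/-- There are finitely many supports, so two powers of `h` share one. Cancelling the smaller power
leaves a power with the support of `e`, hence equal to `e`. -/
theorem Matrix.exists_pow_eq_of_bounded_group {e h h' : Matrix Q Q ℝ} {M : ℝ}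
    (he0 : ∀ i j, 0 ≤ e i j) (hh0 : ∀ i j, 0 ≤ h i j) (hh'0 : ∀ i j, 0 ≤ h' i j)
    (hM : ∀ n i j, (h ^ n) i j ≤ M) (hM' : ∀ n i j, (h' ^ n) i j ≤ M) (hee : e * e = e)
    (hh'h : h' * h = e) (hhh' : h * h' = e) (hhe : h * e = h) (heh : e * h = h) (hh'e : h' * e = h') :
    ∃ D : ℕ, 0 < D ∧ h ^ D = e := by
  -- Exponents are positive throughout: the zeroth power is the identity matrix, not the group
  -- identity `e`.
  obtain ⟨a, b, hab, hsupp⟩ := Finite.exists_ne_map_eq_of_infinite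
    (fun (n : ℕ) (i j : Q) => ((h ^ (n + 1)) i j ≠ 0))
  wlog hlt : a < b generalizing a b
  · exact this b a hab.symm hsupp.symm (lt_of_le_of_ne (not_lt.1 hlt) hab.symm)
  have hss : (h ^ (b + 1)).SameSupport (h ^ (a + 1)) := fun i j => by
    exact (iff_of_eq (congrFun (congrFun hsupp i) j)).symm
  have hinv : ∀ n : ℕ, h ^ (n + 1) * h' ^ (n + 1) = e := by
    intro n
    induction n with
    | zero => simpa using hhh'
    | succ n ih =>
      rw [pow_succ' h (n + 1), pow_succ h' (n + 1), mul_assoc, ← mul_assoc (h ^ (n + 1)), ih,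
        ← mul_assoc, hhe, hhh']
  have hinv' : ∀ n : ℕ, h' ^ (n + 1) * h ^ (n + 1) = e := by
    intro n
    induction n with
    | zero => simpa using hh'h
    | succ n ih =>
      rw [pow_succ' h' (n + 1), pow_succ h (n + 1), mul_assoc, ← mul_assoc (h' ^ (n + 1)), ih,
        ← mul_assoc, hh'e, hh'h]
  have hpe : ∀ n : ℕ, h ^ (n + 1) * e = h ^ (n + 1) := fun n => by rw [pow_succ, mul_assoc, hhe]
  have hep : ∀ n : ℕ, e * h ^ (n + 1) = h ^ (n + 1) := fun n => by rw [pow_succ', ← mul_assoc, heh]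
  have hpe' : ∀ n : ℕ, h' ^ (n + 1) * e = h' ^ (n + 1) := fun n => by rw [pow_succ, mul_assoc, hh'e]
  obtain ⟨c, rfl⟩ : ∃ c, b = a + c + 1 := ⟨b - a - 1, by omega⟩
  refine ⟨c + 1, c.succ_pos, ?_⟩
  have hps : (h ^ (c + 1)).SameSupport e := by
    have := Matrix.SameSupport.mul (Matrix.pow_apply_nonneg hh0 _) (Matrix.pow_apply_nonneg hh0 _)
      (Matrix.pow_apply_nonneg hh'0 (a + 1)) (Matrix.pow_apply_nonneg hh'0 (a + 1)) hss
      (fun _ _ => Iff.rfl)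
    rwa [hinv, show a + c + 1 + 1 = (c + 1) + (a + 1) by ring, pow_add, mul_assoc, hinv, hpe]
      at this
  exact Matrix.eq_of_sameSupport (h' := h' ^ (c + 1)) (M := M) he0 (Matrix.pow_apply_nonneg hh0 _)
    (Matrix.pow_apply_nonneg hh'0 _) (fun n i j => by rw [← pow_mul]; exact hM _ _ _)
    (fun n i j => by rw [← pow_mul]; exact hM' _ _ _) hee (hinv' c) (hpe c) (hep c) (hpe' c) hps

/-- The powers of a power-bounded nonnegative matrix converge along an arithmetic progression. -/
theorem Matrix.exists_tendsto_pow_mul {K : Matrix Q Q ℝ} {M : ℝ} (h0 : ∀ i j, 0 ≤ K i j)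
    (hM : ∀ n i j, (K ^ n) i j ≤ M) :
    ∃ D : ℕ, 0 < D ∧ ∃ e : Matrix Q Q ℝ, Tendsto (fun n => K ^ (D * n)) atTop (𝓝 e) := by
  set ω : Set (Matrix Q Q ℝ) := {X | MapClusterPt X atTop (fun n => K ^ n)} with hω
  set box : Set (Matrix Q Q ℝ) := Set.univ.pi fun _ => Set.univ.pi fun _ => Set.Icc 0 M with hbox
  have hboxc : IsCompact box := isCompact_univ_pi fun _ => isCompact_univ_pi fun _ => isCompact_Icc
  have hKbox : ∀ n, K ^ n ∈ box := fun n i _ j _ => ⟨Matrix.pow_apply_nonneg h0 n i j, hM n i j⟩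
  have hωbox : ω ⊆ box := fun X hX =>
    hboxc.isClosed.mem_of_mapClusterPt hX (Eventually.of_forall hKbox)
  have hωc : IsCompact ω := hboxc.of_isClosed_subset isClosed_setOfPred_clusterPt hωbox
  have hωne : ω.Nonempty := by
    obtain ⟨X, -, hX⟩ := hboxc.exists_mapClusterPt (f := atTop) (u := fun n => K ^ n)
      (tendsto_principal.2 (Eventually.of_forall hKbox))
    exact ⟨X, hX⟩
  have hωmul : ∀ X ∈ ω, ∀ Y ∈ ω, X * Y ∈ ω := by
    intro X hX Y hY
    obtain ⟨f, hf, hfX⟩ := mapClusterPt_iff_ultrafilter.1 hX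
    obtain ⟨g, hg, hgY⟩ := mapClusterPt_iff_ultrafilter.1 hY
    have h1 : Tendsto (fun z : ℕ × ℕ => K ^ (z.1 + z.2)) (f ×ˢ g) (𝓝 (X * Y)) := by
      simp only [pow_add]
      exact (hfX.comp tendsto_fst).mul (hgY.comp tendsto_snd)
    have h2 : Tendsto (fun z : ℕ × ℕ => z.1 + z.2) ((f : Filter ℕ) ×ˢ (g : Filter ℕ)) atTop :=
      (tendsto_id'.2 hf |>.comp tendsto_fst).atTop_add_nonneg fun z => Nat.zero_le _
    exact MapClusterPt.of_comp h2 h1.mapClusterPt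
  -- The cluster points of the powers form a compact semigroup, which contains an idempotent
  -- (Ellis–Numakura).
  obtain ⟨e, he, hee⟩ := exists_idempotent_in_compact_subsemigroup
    (fun r : Matrix Q Q ℝ => continuous_id.mul continuous_const) ω hωne hωc hωmul
  have hcommK : ∀ X ∈ ω, K * X = X * K := by
    intro X hX
    obtain ⟨f, -, hfX⟩ := mapClusterPt_iff_ultrafilter.1 hX
    refine tendsto_nhds_unique (hfX.const_mul K) ((hfX.mul_const K).congr fun n => ?_)
    rw [← pow_succ, ← pow_succ']
  have hcomm : ∀ X ∈ ω, ∀ Y ∈ ω, X * Y = Y * X := by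
    intro X hX Y hY
    obtain ⟨f, -, hfX⟩ := mapClusterPt_iff_ultrafilter.1 hX
    refine tendsto_nhds_unique (hfX.mul_const Y) ((hfX.const_mul Y).congr fun n => ?_)
    exact ((show Commute K Y from hcommK Y hY).pow_left n).symm.eq
  have hωK : ∀ X ∈ ω, K * X ∈ ω := by
    intro X hX
    obtain ⟨f, hf, hfX⟩ := mapClusterPt_iff_ultrafilter.1 hX
    have h1 : Tendsto (fun n : ℕ => K ^ (n + 1)) f (𝓝 (K * X)) := by
      simp only [pow_succ']
      exact hfX.const_mul K
    exact MapClusterPt.of_comp ((tendsto_add_atTop_nat 1).mono_left hf) h1.mapClusterPt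
  -- A limit of `K ^ (n - 1)` along an ultrafilter for which `K ^ n` tends to `e`; it makes `k * e`
  -- the inverse of `K * e` in a group with identity `e`.
  obtain ⟨k, hk, hKk⟩ : ∃ k ∈ ω, K * k = e := by
    obtain ⟨f, hf, hfe⟩ := mapClusterPt_iff_ultrafilter.1 he
    obtain ⟨k, -, hk⟩ := hboxc.ultrafilter_le_nhds (f.map fun n : ℕ => K ^ (n - 1))
      (le_principal_iff.2 (Ultrafilter.mem_map.2 (Eventually.of_forall fun n => hKbox (n - 1))))
    have hk' : Tendsto (fun n : ℕ => K ^ (n - 1)) f (𝓝 k) := hk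
    refine ⟨k, MapClusterPt.of_comp ((tendsto_sub_atTop_nat 1).mono_left hf) hk'.mapClusterPt, ?_⟩
    refine tendsto_nhds_unique ((hk'.const_mul K).congr' ?_) hfe
    filter_upwards [hf (eventually_ge_atTop 1)] with n hn
    rw [← pow_succ', Nat.sub_add_cancel hn]
  have hbd : ∀ X ∈ ω, ∀ n i j, ((X * e) ^ (n + 1)) i j ≤ M ∧ 0 ≤ ((X * e) ^ (n + 1)) i j := by
    intro X hX n i j
    have : (X * e) ^ (n + 1) ∈ ω := by
      induction n with
      | zero => rw [zero_add, pow_one]; exact hωmul X hX e he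
      | succ n ih => rw [pow_succ]; exact hωmul _ ih _ (hωmul X hX e he)
    exact ⟨(hωbox this i trivial j trivial).2, (hωbox this i trivial j trivial).1⟩
  have hbd1 : ∀ X ∈ ω, ∀ n i j, ((X * e) ^ n) i j ≤ max M 1 := by
    intro X hX n i j
    cases n with
    | zero =>
      rw [pow_zero, Matrix.one_apply]
      split_ifs
      · exact le_max_right _ _
      · exact le_max_of_le_right zero_le_one
    | succ n => exact le_max_of_le_left (hbd X hX n i j).1
  have hge : K * e * e = K * e := by rw [mul_assoc, hee]
  have hkee : k * e * e = k * e := by rw [mul_assoc, hee]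
  have hkg : k * e * (K * e) = e := by
    rw [← mul_assoc, mul_assoc k e K, ← hcommK e he, ← mul_assoc, ← hcommK k hk, hKk, hee, hee]
  have hKee : K * e ∈ ω := hωK e he
  have hkeω : k * e ∈ ω := hωmul k hk e he
  obtain ⟨D, hD, hDe⟩ := Matrix.exists_pow_eq_of_bounded_group (e := e) (h := K * e) (h' := k * e)
    (M := max M 1) (fun i j => (hωbox he i trivial j trivial).1)
    (fun i j => (hωbox hKee i trivial j trivial).1)
    (fun i j => (hωbox hkeω i trivial j trivial).1)
    (fun n i j => by have := hbd1 (K * e) hKee n i j; rwa [hge] at this)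
    (hbd1 k hk) hee hkg (by rw [hcomm _ hKee _ hkeω, hkg]) hge
    (by rw [hcomm _ he _ hKee, hge]) hkee
  refine ⟨D, hD, e, ?_⟩
  have hKDe : K ^ D * e = e := by
    have h1 : K ^ D * e ^ D = e := by rw [← (show Commute K e from hcommK e he).mul_pow, hDe]
    have h2 : e ^ D = e := by
      obtain ⟨c, rfl⟩ : ∃ c, D = c + 1 := ⟨D - 1, by omega⟩
      clear * - hee
      induction c with
      | zero => simp
      | succ c ih => rw [pow_succ, ih, hee]
    rwa [h2] at h1
  have hKDn : ∀ n, K ^ (D * n) * e = e := by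
    intro n
    induction n with
    | zero => simp
    | succ n ih => rw [Nat.mul_succ, pow_add, mul_assoc, hKDe, ih]
  obtain ⟨f, hf, hfe⟩ := mapClusterPt_iff_ultrafilter.1 he
  have hto0 : Tendsto (fun n => K ^ n * (1 - e)) f (𝓝 0) := by
    have := hfe.mul_const (1 - e)
    rwa [mul_sub, mul_one, hee, sub_self] at this
  -- Smallness at a single exponent `N` persists, since all later factors `K ^ c` are bounded.
  have hall : Tendsto (fun n => K ^ n * (1 - e)) atTop (𝓝 0) := by
    refine tendsto_pi_nhds.2 fun i => tendsto_pi_nhds.2 fun j => ?_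
    rw [Metric.tendsto_atTop]
    intro ε hε
    have hpt : ∀ a, ∀ᶠ n in (f : Filter ℕ), |(K ^ n * (1 - e)) a j| <
        ε / (Fintype.card Q * (|M| + 1) + 1) := by
      intro a
      have h1 := tendsto_pi_nhds.1 (tendsto_pi_nhds.1 hto0 a) j
      have hpos : 0 < ε / (Fintype.card Q * (|M| + 1) + 1) := by positivity
      filter_upwards [Metric.tendsto_nhds.1 h1 _ hpos] with n hn
      simpa [Real.dist_eq] using hn
    obtain ⟨N, hN⟩ := (eventually_all.2 hpt).exists
    refine ⟨N, fun n hn => ?_⟩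
    obtain ⟨c, rfl⟩ := Nat.exists_eq_add_of_le' hn
    rw [Real.dist_eq, Matrix.zero_apply, sub_zero, pow_add, mul_assoc, Matrix.mul_apply]
    calc |∑ a, (K ^ c) i a * (K ^ N * (1 - e)) a j|
        ≤ ∑ a, |(K ^ c) i a * (K ^ N * (1 - e)) a j| := Finset.abs_sum_le_sum_abs _ _
      _ ≤ ∑ _a : Q, (|M| + 1) * (ε / (Fintype.card Q * (|M| + 1) + 1)) := by
          refine Finset.sum_le_sum fun a _ => ?_
          rw [abs_mul]
          refine mul_le_mul ?_ (hN a).le (abs_nonneg _) (by positivity)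
          rw [abs_of_nonneg (Matrix.pow_apply_nonneg h0 c i a)]
          linarith [hM c i a, le_abs_self M]
      _ = ε * ((Fintype.card Q * (|M| + 1)) / (Fintype.card Q * (|M| + 1) + 1)) := by
          rw [Finset.sum_const, Finset.card_univ, nsmul_eq_mul]; ring
      _ < ε * 1 := by
          refine mul_lt_mul_of_pos_left ?_ hε
          rw [div_lt_one (by positivity)]
          linarith
      _ = ε := mul_one ε
  have hDt : Tendsto (fun n : ℕ => D * n) atTop atTop := tendsto_id.const_mul_atTop' hD
  have := (hall.comp hDt).add_const e
  rw [zero_add] at this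
  refine this.congr fun n => ?_
  simp only [Function.comp_apply]
  rw [mul_sub, mul_one, hKDn, sub_add_cancel]

end NonnegMatrix

/-! ### Greedy representations and a recognizing automaton -/

namespace PositionalSystem

variable (S : PositionalSystem)

theorem U_pos (n : ℕ) : 0 < S.U n :=
  lt_of_lt_of_le (by rw [S.zero_eq_one]; exact one_pos) (S.increasing.monotone n.zero_le)

theorem lt_U (n : ℕ) : n < S.U n := by
  induction n with
  | zero => exact S.U_pos 0
  | succ n ih => exact lt_of_le_of_lt ih (S.increasing n.lt_succ_self)

theorem exists_ratio_bound : ∃ C : ℕ, 0 < C ∧ ∀ n, S.U (n + 1) ≤ C * S.U n := by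
  obtain ⟨C, hC⟩ := S.bounded_quotients
  refine ⟨⌈C⌉₊ + 1, Nat.succ_pos _, fun n => ?_⟩
  have h := hC n
  rw [div_le_iff₀ (by exact_mod_cast S.U_pos n)] at h
  have h2 : (S.U (n + 1) : ℝ) ≤ ((⌈C⌉₊ + 1 : ℕ) : ℝ) * S.U n := by
    refine h.trans (mul_le_mul_of_nonneg_right ?_ (Nat.cast_nonneg _))
    push_cast
    linarith [Nat.le_ceil C]
  exact_mod_cast h2

theorem lt_alphabetSize {n r : ℕ} (h : r < S.U (n + 1)) : r / S.U n < S.alphabetSize := by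
  obtain ⟨C, hC⟩ := S.bounded_quotients
  have hbdd : BddAbove (Set.range fun n => ⌈(S.U (n + 1) : ℝ) / (S.U n : ℝ)⌉₊) :=
    ⟨⌈C⌉₊, by rintro _ ⟨n, rfl⟩; exact Nat.ceil_mono (hC n)⟩
  refine lt_of_lt_of_le ?_ (le_ciSup hbdd n)
  rw [Nat.lt_ceil]
  have hU : (0 : ℝ) < S.U n := by exact_mod_cast S.U_pos n
  refine lt_of_le_of_lt Nat.cast_div_le ?_
  exact div_lt_div_of_pos_right (by exact_mod_cast h) hU

theorem repLength_le_iff {x n : ℕ} : S.repLength x ≤ n ↔ x < S.U n := by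
  constructor
  · intro h
    have hmem : S.repLength x ∈ {l : ℕ | x < S.U l} := Nat.sInf_mem ⟨x, S.lt_U x⟩
    exact lt_of_lt_of_le hmem (S.increasing.monotone h)
  · intro h
    exact Nat.sInf_le h

@[simp]
theorem length_greedyDigits (n x : ℕ) : (S.greedyDigits n x).length = n := by
  induction n generalizing x with
  | zero => rfl
  | succ n ih => simp [greedyDigits, ih]

theorem greedyDigits_lt_alphabetSize {n x : ℕ} (h : x < S.U n) :
    ∀ d ∈ S.greedyDigits n x, d < S.alphabetSize := by
  induction n generalizing x with
  | zero => simp [greedyDigits]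
  | succ n ih =>
    intro d hd
    rw [greedyDigits, List.mem_cons] at hd
    rcases hd with rfl | hd
    · exact S.lt_alphabetSize h
    · exact ih (Nat.mod_lt _ (S.U_pos n)) d hd

theorem greedyDigits_add_of_lt {k x : ℕ} (h : x < S.U k) (j : ℕ) :
    S.greedyDigits (j + k) x = List.replicate j 0 ++ S.greedyDigits k x := by
  induction j with
  | zero => simp
  | succ j ih =>
    have hlt : x < S.U (j + k) := lt_of_lt_of_le h (S.increasing.monotone (Nat.le_add_left _ _))
    rw [show j + 1 + k = j + k + 1 by ring, greedyDigits, Nat.div_eq_of_lt hlt, Nat.mod_eq_of_lt hlt,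
      ih, List.replicate_succ, List.cons_append]

theorem greedyDigits_injOn {n x y : ℕ} (hx : x < S.U n) (hy : y < S.U n)
    (h : S.greedyDigits n x = S.greedyDigits n y) : x = y := by
  induction n generalizing x y with
  | zero => rw [S.zero_eq_one] at hx hy; omega
  | succ n ih =>
    simp only [greedyDigits, List.cons.injEq] at h
    have := ih (Nat.mod_lt _ (S.U_pos n)) (Nat.mod_lt _ (S.U_pos n)) h.2
    rw [← Nat.div_add_mod x (S.U n), ← Nat.div_add_mod y (S.U n), this, h.1]

theorem greedyDigits_lex {n x y : ℕ} (hxy : x ≤ y) {u v w : List ℕ} {a d : ℕ}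
    (hx : S.greedyDigits n x = u ++ d :: w) (hy : S.greedyDigits n y = u ++ a :: v) : d ≤ a := by
  induction n generalizing x y u with
  | zero => simp [greedyDigits] at hx
  | succ n ih =>
    rw [greedyDigits] at hx hy
    cases u with
    | nil =>
      simp only [List.nil_append, List.cons.injEq] at hx hy
      rw [← hx.1, ← hy.1]
      exact Nat.div_le_div_right hxy
    | cons c u =>
      simp only [List.cons_append, List.cons.injEq] at hx hy
      refine ih ?_ hx.2 hy.2
      have h1 := Nat.div_add_mod x (S.U n)
      have h2 := Nat.div_add_mod y (S.U n)
      rw [hx.1] at h1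
      rw [hy.1] at h2
      omega

/-- Starting the greedy algorithm at too high an index only prepends zeros. -/
theorem mem_numerationLanguage_iff {w : List S.Alphabet} :
    w ∈ S.numerationLanguage ↔
      ∃ x < S.U w.length, w.map Fin.val = S.greedyDigits w.length x := by
  constructor
  · rintro ⟨k, x, h⟩
    have hlen := congrArg List.length h
    simp only [List.length_map, List.length_append, List.length_replicate, rep,
      length_greedyDigits] at hlen
    have hx : x < S.U (S.repLength x) := S.repLength_le_iff.1 le_rfl
    refine ⟨x, S.repLength_le_iff.1 (by omega), ?_⟩
    rw [h, hlen, S.greedyDigits_add_of_lt hx, rep]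
  · rintro ⟨x, hx, h⟩
    refine ⟨w.length - S.repLength x, x, ?_⟩
    have hle := S.repLength_le_iff.2 hx
    rw [h, rep, ← S.greedyDigits_add_of_lt (S.repLength_le_iff.1 le_rfl), Nat.sub_add_cancel hle]

/-- The automaton `M`, reading natural numbers, accepts the greedy representations padded with
leading zeros. -/
def Recognizes {Q : Type} (M : DFA ℕ Q) : Prop :=
  ∀ v : List ℕ, M.evalFrom M.start v ∈ M.accept ↔
    ∃ x < S.U v.length, v = S.greedyDigits v.length x

variable {S}

/-- A sink state `none` absorbs every letter outside the alphabet, which allows reading words over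
`ℕ`. -/
theorem exists_recognizes (hS : S.numerationLanguage.IsRegular) :
    ∃ (Q : Type) (_ : Fintype Q) (M : DFA ℕ Q), S.Recognizes M := by
  obtain ⟨σ, _, M, hM⟩ := hS
  let M' : DFA ℕ (Option σ) :=
    { step := fun q d => q.bind fun q => if h : d < S.alphabetSize then some (M.step q ⟨d, h⟩)
        else none
      start := some M.start
      accept := some '' M.accept }
  have hnone : ∀ v, M'.evalFrom none v = none := by
    intro v
    induction v with
    | nil => rfl
    | cons d v ih => rw [DFA.evalFrom_cons]; exact ih
  have hsome : ∀ (w : List S.Alphabet) q,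
      M'.evalFrom (some q) (w.map Fin.val) = some (M.evalFrom q w) := by
    intro w
    induction w with
    | nil => intro q; rfl
    | cons d w ih =>
      intro q
      rw [List.map_cons, DFA.evalFrom_cons, DFA.evalFrom_cons, ← ih]
      congr 1
      simp [M']
  have hlift : ∀ (v : List ℕ) q, M'.evalFrom (some q) v ≠ none → ∀ d ∈ v, d < S.alphabetSize := by
    intro v
    induction v with
    | nil => simp
    | cons d v ih =>
      intro q h
      rw [DFA.evalFrom_cons] at h
      by_cases hd : d < S.alphabetSize
      · have hst : M'.step (some q) d = some (M.step q ⟨d, hd⟩) := by simp [M', hd]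
        rw [hst] at h
        intro c hc
        rcases List.mem_cons.1 hc with rfl | hc
        · exact hd
        · exact ih _ h c hc
      · have hst : M'.step (some q) d = none := by simp [M', hd]
        rw [hst] at h
        exact absurd (hnone v) h
  have hmap : ∀ v : List ℕ, (∀ d ∈ v, d < S.alphabetSize) →
      ∃ w : List S.Alphabet, w.map Fin.val = v := by
    intro v
    induction v with
    | nil => intro _; exact ⟨[], rfl⟩
    | cons d v ih =>
      intro h
      obtain ⟨w, rfl⟩ := ih fun c hc => h c (List.mem_cons_of_mem _ hc)
      exact ⟨⟨d, h d List.mem_cons_self⟩ :: w, rfl⟩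
  have hword : ∀ w : List S.Alphabet, M'.evalFrom M'.start (w.map Fin.val) ∈ M'.accept ↔
      ∃ x < S.U w.length, w.map Fin.val = S.greedyDigits w.length x := by
    intro w
    rw [← S.mem_numerationLanguage_iff, ← hM, DFA.mem_accepts]
    change M'.evalFrom (some M.start) _ ∈ some '' M.accept ↔ M.evalFrom M.start w ∈ _
    rw [hsome]
    simp
  refine ⟨Option σ, inferInstance, M', fun v => ⟨fun h => ?_, fun h => ?_⟩⟩
  · obtain ⟨w, rfl⟩ := hmap v (hlift v M.start (by
      rintro h0
      obtain ⟨q, -, hq⟩ := h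
      change some q = M'.evalFrom (some M.start) v at hq
      rw [h0] at hq
      exact absurd hq (by simp)))
    have := (hword w).1 h
    rwa [List.length_map]
  · obtain ⟨x, hx, hv⟩ := h
    obtain ⟨w, rfl⟩ := hmap v (by rw [hv]; exact S.greedyDigits_lt_alphabetSize hx)
    rw [List.length_map] at hx hv
    exact (hword w).2 ⟨x, hx, hv⟩

/-! ### The greedy word of `U_n - 1` and its periodicity in `n` -/

variable (S)

/-- Remainders of the greedy algorithm applied to `U_n - 1`. -/
def maxRem (n : ℕ) : ℕ → ℕ
  | 0 => S.U n - 1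
  | k + 1 => maxRem n k % S.U (n - 1 - k)

/-- Digits of the greedy representation of `U_n - 1`, most significant first. -/
def maxDigit (n k : ℕ) : ℕ := S.maxRem n k / S.U (n - 1 - k)

/-- The state reached after reading `k` digits of the greedy representation of `U_n - 1`. -/
def maxState {Q : Type} (M : DFA ℕ Q) (n : ℕ) : ℕ → Q
  | 0 => M.start
  | k + 1 => M.step (maxState M n k) (S.maxDigit n k)

theorem maxRem_succ (n k : ℕ) :
    S.maxDigit n k * S.U (n - 1 - k) + S.maxRem n (k + 1) = S.maxRem n k := by
  rw [maxDigit, maxRem, mul_comm, Nat.div_add_mod]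

theorem maxRem_lt {n k : ℕ} (hk : k ≤ n) : S.maxRem n k < S.U (n - k) := by
  cases k with
  | zero => have := S.U_pos n; simp only [maxRem, Nat.sub_zero]; omega
  | succ k =>
    rw [maxRem, show n - (k + 1) = n - 1 - k by omega]
    exact Nat.mod_lt _ (S.U_pos _)

theorem sum_maxDigit_add_maxRem (n t : ℕ) :
    ∑ k ∈ Finset.range t, S.maxDigit n k * S.U (n - 1 - k) + S.maxRem n t = S.U n - 1 := by
  induction t with
  | zero => simp [maxRem]
  | succ t ih => rw [Finset.sum_range_succ, add_assoc, maxRem_succ, ih]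

theorem one_le_maxDigit_zero {n : ℕ} (hn : 0 < n) : 1 ≤ S.maxDigit n 0 := by
  rw [maxDigit, Nat.le_div_iff_mul_le (S.U_pos _), maxRem]
  have := S.increasing (show n - 1 - 0 < n by omega)
  omega

theorem exists_greedyDigits_max_eq {Q : Type} (M : DFA ℕ Q) {n k : ℕ} (hk : k ≤ n) :
    ∃ u : List ℕ, u.length = k ∧ M.evalFrom M.start u = S.maxState M n k ∧
      S.greedyDigits n (S.U n - 1) = u ++ S.greedyDigits (n - k) (S.maxRem n k) := by
  induction k with
  | zero => exact ⟨[], rfl, rfl, rfl⟩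
  | succ k ih =>
    obtain ⟨u, hu, hs, hd⟩ := ih (by omega)
    refine ⟨u ++ [S.maxDigit n k], by simp [hu], ?_, ?_⟩
    · rw [DFA.evalFrom_append_singleton, hs, maxState]
    · rw [hd, show n - k = (n - 1 - k) + 1 by omega, greedyDigits,
        show n - (k + 1) = n - 1 - k by omega, List.append_assoc]
      rfl

end PositionalSystem

/-- The states from which some word of length `m` is accepted. -/
def DFA.live {α Q : Type} (M : DFA α Q) (m : ℕ) : Set Q :=
  {q | ∃ w : List α, w.length = m ∧ M.evalFrom q w ∈ M.accept}

theorem DFA.live_succ {α Q : Type} (M : DFA α Q) (m : ℕ) :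
    M.live (m + 1) = {q | ∃ d, M.step q d ∈ M.live m} := by
  ext q
  constructor
  · rintro ⟨w, hw, h⟩
    cases w with
    | nil => simp at hw
    | cons d w => exact ⟨d, w, by simpa using hw, by simpa using h⟩
  · rintro ⟨d, w, hw, h⟩
    exact ⟨d :: w, by simp [hw], by simpa using h⟩

/-- Each live set determines the next, and there are finitely many sets of states. -/
theorem DFA.exists_live_periodic {α Q : Type} [Finite Q] (M : DFA α Q) :
    ∃ N P : ℕ, 0 < P ∧ ∀ m, N ≤ m → M.live (m + P) = M.live m := by
  obtain ⟨a, b, hab, h⟩ := Finite.exists_ne_map_eq_of_infinite M.live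
  wlog hlt : a < b generalizing a b
  · exact this b a hab.symm h.symm (lt_of_le_of_ne (not_lt.1 hlt) hab.symm)
  refine ⟨a, b - a, by omega, fun m hm => ?_⟩
  induction m, hm using Nat.le_induction with
  | base => rw [Nat.add_sub_cancel' hlt.le, h]
  | succ m hm ih => rw [show m + 1 + (b - a) = m + (b - a) + 1 by ring, M.live_succ, M.live_succ, ih]

namespace PositionalSystem

variable {S : PositionalSystem} {Q : Type} {M : DFA ℕ Q}

/-- Among accepted words of length `n`, that of `U_n - 1` is lexicographically greatest. Its digits
are thus functions of the state and the live set alone. -/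
theorem Recognizes.isGreatest_maxDigit (hM : S.Recognizes M) {n k : ℕ} (hk : k < n) :
    IsGreatest {d | M.step (S.maxState M n k) d ∈ M.live (n - 1 - k)} (S.maxDigit n k) := by
  have hacc : M.evalFrom M.start (S.greedyDigits n (S.U n - 1)) ∈ M.accept :=
    (hM _).2 ⟨S.U n - 1, by rw [length_greedyDigits]; have := S.U_pos n; omega,
      by rw [length_greedyDigits]⟩
  constructor
  · obtain ⟨u, hu, hs, hd⟩ := S.exists_greedyDigits_max_eq M (Nat.succ_le_of_lt hk)
    refine ⟨S.greedyDigits (n - 1 - k) (S.maxRem n (k + 1)), length_greedyDigits _ _ _, ?_⟩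
    rw [hd, DFA.evalFrom_of_append, hs] at hacc
    rwa [show n - 1 - k = n - (k + 1) by omega]
  · rintro d ⟨w, hw, h⟩
    obtain ⟨u, hu, hs, hd⟩ := S.exists_greedyDigits_max_eq M hk.le
    have h' : M.evalFrom M.start (u ++ d :: w) ∈ M.accept := by
      rwa [DFA.evalFrom_of_append, hs, DFA.evalFrom_cons]
    obtain ⟨x, hx, hxe⟩ := (hM _).1 h'
    have hlen : (u ++ d :: w).length = n := by
      rw [List.length_append, List.length_cons, hu, hw]; omega
    rw [hlen] at hx hxe
    rw [show n - k = (n - 1 - k) + 1 by omega, greedyDigits] at hd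
    exact S.greedyDigits_lex (by omega) hxe.symm hd

theorem Recognizes.maxDigit_eq (hM : S.Recognizes M) {n k n' k' : ℕ} (hk : k < n) (hk' : k' < n')
    (hs : S.maxState M n k = S.maxState M n' k')
    (hl : M.live (n - 1 - k) = M.live (n' - 1 - k')) : S.maxDigit n k = S.maxDigit n' k' := by
  have h := hM.isGreatest_maxDigit hk
  rw [hs, hl] at h
  exact h.unique (hM.isGreatest_maxDigit hk')

/-- While at least `N` letters remain, the live sets for lengths `n` and `n + P` agree, so both runs
choose the same digits. -/
theorem Recognizes.maxState_add_period (hM : S.Recognizes M) {N P : ℕ}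
    (hP : ∀ m, N ≤ m → M.live (m + P) = M.live m) {n k : ℕ} (hk : k + N ≤ n) :
    S.maxState M (n + P) k = S.maxState M n k := by
  induction k with
  | zero => rfl
  | succ k ih =>
    have h := ih (by omega)
    rw [maxState, maxState, h]
    congr 1
    refine hM.maxDigit_eq (by omega) (by omega) h ?_
    rw [show n + P - 1 - k = n - 1 - k + P by omega]
    exact hP _ (by omega)

theorem Recognizes.maxDigit_add_period (hM : S.Recognizes M) {N P : ℕ}
    (hP : ∀ m, N ≤ m → M.live (m + P) = M.live m) {n k : ℕ} (hk : k + N < n) :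
    S.maxDigit (n + P) k = S.maxDigit n k := by
  refine hM.maxDigit_eq (by omega) (by omega) (hM.maxState_add_period hP hk.le) ?_
  rw [show n + P - 1 - k = n - 1 - k + P by omega]
  exact hP _ (by omega)

theorem Recognizes.maxState_add_mul_period (hM : S.Recognizes M) {N P : ℕ}
    (hP : ∀ m, N ≤ m → M.live (m + P) = M.live m) {n k : ℕ} (hk : k + N ≤ n) (c : ℕ) :
    S.maxState M (n + c * P) k = S.maxState M n k := by
  induction c with
  | zero => simp
  | succ c ih => rw [Nat.succ_mul, ← add_assoc, hM.maxState_add_period hP (by omega), ih]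

theorem Recognizes.maxDigit_add_mul_period (hM : S.Recognizes M) {N P : ℕ}
    (hP : ∀ m, N ≤ m → M.live (m + P) = M.live m) {n k : ℕ} (hk : k + N < n) (c : ℕ) :
    S.maxDigit (n + c * P) k = S.maxDigit n k := by
  induction c with
  | zero => simp
  | succ c ih => rw [Nat.succ_mul, ← add_assoc, hM.maxDigit_add_period hP (by omega), ih]

theorem Recognizes.maxDigit_of_maxState_eq (hM : S.Recognizes M) {k k' m : ℕ}
    (hs : S.maxState M (k + m) k = S.maxState M (k' + m) k') {i : ℕ} (hi : i < m) :
    S.maxDigit (k + m) (k + i) = S.maxDigit (k' + m) (k' + i) := by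
  have key : ∀ i < m, S.maxState M (k + m) (k + i) = S.maxState M (k' + m) (k' + i) →
      S.maxDigit (k + m) (k + i) = S.maxDigit (k' + m) (k' + i) := fun i hi h =>
    hM.maxDigit_eq (by omega) (by omega) h (by congr 1; omega)
  refine key i hi ?_
  induction i with
  | zero => exact hs
  | succ i ih =>
    have h := ih (by omega)
    rw [← add_assoc, ← add_assoc, maxState, maxState, key i (by omega) h, h]

end PositionalSystem

/-! ### Counting accepted words by matrix powers -/

section Counting

variable {Q : Type} [Fintype Q] [DecidableEq Q]

/-- The number of letters in `{0, …, b - 1}` leading from one state to another. -/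
def DFA.transitionMatrix (M : DFA ℕ Q) (b : ℕ) : Matrix Q Q ℝ :=
  fun q q' => ((Finset.range b).filter fun d => M.step q d = q').card

/-- The words of length `n` over `{0, …, b - 1}`. -/
def boundedWords (b : ℕ) : ℕ → Finset (List ℕ)
  | 0 => {[]}
  | n + 1 => (Finset.range b ×ˢ boundedWords b n).image fun x => x.1 :: x.2

theorem mem_boundedWords {b n : ℕ} {w : List ℕ} :
    w ∈ boundedWords b n ↔ w.length = n ∧ ∀ d ∈ w, d < b := by
  induction n generalizing w with
  | zero =>
    simp only [boundedWords, Finset.mem_singleton, List.length_eq_zero_iff]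
    constructor
    · rintro rfl; simp
    · exact fun h => h.1
  | succ n ih =>
    simp only [boundedWords, Finset.mem_image, Finset.mem_product, Finset.mem_range,
      Prod.exists, ih]
    constructor
    · rintro ⟨d, v, ⟨hd, hv, hv'⟩, rfl⟩
      refine ⟨by simp [hv], ?_⟩
      simpa using ⟨hd, hv'⟩
    · rintro ⟨hl, hw⟩
      cases w with
      | nil => simp at hl
      | cons d v =>
        simp only [List.length_cons, add_left_inj] at hl
        simp only [List.mem_cons, forall_eq_or_imp] at hw
        exact ⟨d, v, ⟨hw.1, hl, hw.2⟩, rfl⟩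

theorem DFA.sum_transitionMatrix_mul (M : DFA ℕ Q) (b : ℕ) (f : Q → ℝ) (q : Q) :
    ∑ q', M.transitionMatrix b q q' * f q' = ∑ d ∈ Finset.range b, f (M.step q d) := by
  rw [← Finset.sum_fiberwise_of_maps_to (s := Finset.range b) (t := Finset.univ)
    (g := fun d => M.step q d) (fun _ _ => Finset.mem_univ _)]
  refine Finset.sum_congr rfl fun q' _ => ?_
  rw [Finset.sum_congr rfl (g := fun _ => f q')
    (fun d hd => by rw [(Finset.mem_filter.1 hd).2]), Finset.sum_const, nsmul_eq_mul]
  rfl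

open Classical in
theorem DFA.sum_transitionMatrix_pow (M : DFA ℕ Q) (b n : ℕ) (q : Q) :
    ∑ q', (M.transitionMatrix b ^ n) q q' * (if q' ∈ M.accept then 1 else 0) =
      ((boundedWords b n).filter fun w => M.evalFrom q w ∈ M.accept).card := by
  rw [Finset.card_filter, Nat.cast_sum]
  simp only [Nat.cast_ite, Nat.cast_one, Nat.cast_zero]
  induction n generalizing q with
  | zero =>
    simp only [pow_zero, Matrix.one_apply, ite_mul, one_mul, zero_mul, Finset.sum_ite_eq,
      Finset.mem_univ, if_true, boundedWords, Finset.sum_singleton, DFA.evalFrom_nil]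
    rfl
  | succ n ih =>
    have h1 : ∀ q', (M.transitionMatrix b ^ (n + 1)) q q' * (if q' ∈ M.accept then (1 : ℝ) else 0) =
        ∑ r, M.transitionMatrix b q r *
          ((M.transitionMatrix b ^ n) r q' * (if q' ∈ M.accept then (1 : ℝ) else 0)) := by
      intro q'
      rw [pow_succ', Matrix.mul_apply, Finset.sum_mul]
      simp only [mul_assoc]
    simp only [h1]
    rw [Finset.sum_comm]
    simp only [← Finset.mul_sum, ih]
    rw [M.sum_transitionMatrix_mul b
      (fun r => ∑ x ∈ boundedWords b n, if M.evalFrom r x ∈ M.accept then (1 : ℝ) else 0),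
      boundedWords, Finset.sum_image, Finset.sum_product]
    · rfl
    · intro x _ y _ h
      simp only [List.cons.injEq] at h
      exact Prod.ext h.1 h.2

open Classical in
theorem PositionalSystem.Recognizes.sum_transitionMatrix_pow {S : PositionalSystem} {M : DFA ℕ Q}
    (hM : S.Recognizes M) (n : ℕ) :
    ∑ q', (M.transitionMatrix S.alphabetSize ^ n) M.start q' * (if q' ∈ M.accept then 1 else 0) =
      (S.U n : ℝ) := by
  rw [M.sum_transitionMatrix_pow, Nat.cast_inj]
  conv_rhs => rw [← Finset.card_range (S.U n)]
  symm
  refine Finset.card_bij (fun x _ => S.greedyDigits n x) ?_ ?_ ?_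
  · intro x hx
    rw [Finset.mem_range] at hx
    rw [Finset.mem_filter, mem_boundedWords]
    exact ⟨⟨S.length_greedyDigits n x, S.greedyDigits_lt_alphabetSize hx⟩,
      (hM _).2 ⟨x, by rwa [S.length_greedyDigits], by rw [S.length_greedyDigits]⟩⟩
  · intro x hx y hy h
    exact S.greedyDigits_injOn (Finset.mem_range.1 hx) (Finset.mem_range.1 hy) h
  · intro w hw
    rw [Finset.mem_filter, mem_boundedWords] at hw
    obtain ⟨x, hx, hxe⟩ := (hM w).1 hw.2
    rw [hw.1.1] at hx hxe
    exact ⟨x, Finset.mem_range.2 hx, hxe.symm⟩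

end Counting

/-- A nonnegative quasi-additive sequence of at most linear growth is linear up to a constant. -/
theorem exists_abs_sub_mul_le_of_quasiadditive {x : ℕ → ℝ} {c K : ℝ} (hx0 : ∀ n, 0 ≤ x n)
    (hK : ∀ n, x n ≤ n * K) (h : ∀ m n, |x (m + n) - x m - x n| ≤ c) :
    ∃ L : ℝ, ∀ n : ℕ, |x n - n * L| ≤ c := by
  have hc : 0 ≤ c := (abs_nonneg _).trans (h 0 0)
  -- Fekete's lemma applies to both `x + c` and `c - x`. Their limits are opposite, and each bounds
  -- its quotients from below.
  have ha : Subadditive fun n => x n + c := fun m n => by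
    have := abs_le.1 (h m n); dsimp only; linarith
  have hb : Subadditive fun n => c - x n := fun m n => by
    have := abs_le.1 (h m n); dsimp only; linarith
  have hab : BddBelow (Set.range fun n : ℕ => (x n + c) / n) :=
    ⟨0, by rintro _ ⟨n, rfl⟩; exact div_nonneg (add_nonneg (hx0 n) hc) n.cast_nonneg⟩
  have hbb : BddBelow (Set.range fun n : ℕ => (c - x n) / n) := by
    refine ⟨-|K|, ?_⟩
    rintro _ ⟨n, rfl⟩
    dsimp only
    rcases Nat.eq_zero_or_pos n with rfl | hn
    · simp
    · have hn' : (0 : ℝ) < n := by exact_mod_cast hn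
      rw [le_div_iff₀ hn']
      nlinarith [hK n, le_abs_self K]
  have hsum : ha.lim + hb.lim = 0 := by
    refine tendsto_nhds_unique ((ha.tendsto_lim hab).add (hb.tendsto_lim hbb)) ?_
    refine (tendsto_const_div_atTop_nhds_zero_nat (2 * c)).congr fun n => ?_
    rw [← add_div]
    ring_nf
  refine ⟨ha.lim, fun n => ?_⟩
  rcases Nat.eq_zero_or_pos n with rfl | hn
  · have := abs_le.1 (h 0 0)
    simp only [add_zero] at this
    rw [Nat.cast_zero, zero_mul, sub_zero, abs_of_nonneg (hx0 0)]
    linarith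
  · have hn' : (0 : ℝ) < n := by exact_mod_cast hn
    have h1 := ha.lim_le_div hab hn.ne'
    have h2 := hb.lim_le_div hbb hn.ne'
    rw [le_div_iff₀ hn'] at h1 h2
    rw [show hb.lim = -ha.lim by linarith] at h2
    rw [abs_le]
    constructor <;> linarith

namespace PositionalSystem

variable {S : PositionalSystem}

theorem U_add_le_of_ratio_bound {C : ℕ} (hC : ∀ n, S.U (n + 1) ≤ C * S.U n) (n k : ℕ) :
    S.U (n + k) ≤ C ^ k * S.U n := by
  induction k with
  | zero => simp
  | succ k ih =>
    rw [← add_assoc, pow_succ', mul_assoc]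
    exact (hC _).trans (Nat.mul_le_mul_left _ ih)

/-! ### Submultiplicativity and the trimmed automaton -/

section Trim

theorem transitionMatrix_nonneg {Q : Type} [DecidableEq Q] (M : DFA ℕ Q) (b : ℕ) (q q' : Q) :
    0 ≤ M.transitionMatrix b q q' := Nat.cast_nonneg _

variable {Q : Type} [Fintype Q] [DecidableEq Q] {M : DFA ℕ Q}

/-- Some word over `{0, …, b - 1}` leads from the initial state to `q`. -/
def Reachable (M : DFA ℕ Q) (b : ℕ) (q : Q) : Prop :=
  ∃ k, (M.transitionMatrix b ^ k) M.start q ≠ 0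

/-- Some word over `{0, …, b - 1}` leads from `q` to an accepting state. -/
def Coreachable (M : DFA ℕ Q) (b : ℕ) (q : Q) : Prop :=
  ∃ k, ∃ q' ∈ M.accept, (M.transitionMatrix b ^ k) q q' ≠ 0

theorem transitionMatrix_pow_nonneg (M : DFA ℕ Q) (b n : ℕ) (q q' : Q) :
    0 ≤ (M.transitionMatrix b ^ n) q q' :=
  Matrix.pow_apply_nonneg (transitionMatrix_nonneg M b) n q q'

theorem transitionMatrix_pow_mul_le (M : DFA ℕ Q) (b m n : ℕ) (q r q' : Q) :
    (M.transitionMatrix b ^ m) q r * (M.transitionMatrix b ^ n) r q' ≤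
      (M.transitionMatrix b ^ (m + n)) q q' := by
  rw [pow_add, Matrix.mul_apply]
  exact Finset.single_le_sum
    (f := fun r => (M.transitionMatrix b ^ m) q r * (M.transitionMatrix b ^ n) r q')
    (fun a _ => mul_nonneg (transitionMatrix_pow_nonneg M b m q a)
    (transitionMatrix_pow_nonneg M b n a q')) (Finset.mem_univ r)

theorem reachable_start (M : DFA ℕ Q) (b : ℕ) : Reachable M b M.start := ⟨0, by simp⟩

theorem coreachable_of_mem_accept {M : DFA ℕ Q} (b : ℕ) {q : Q} (h : q ∈ M.accept) :
    Coreachable M b q := ⟨0, q, h, by simp⟩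

theorem transitionMatrix_pow_add_ne_zero {M : DFA ℕ Q} {b m n : ℕ} {q r q' : Q}
    (h : (M.transitionMatrix b ^ m) q r ≠ 0) (h' : (M.transitionMatrix b ^ n) r q' ≠ 0) :
    (M.transitionMatrix b ^ (m + n)) q q' ≠ 0 := by
  have h1 := lt_of_le_of_ne (transitionMatrix_pow_nonneg M b m q r) h.symm
  have h2 := lt_of_le_of_ne (transitionMatrix_pow_nonneg M b n r q') h'.symm
  exact (lt_of_lt_of_le (mul_pos h1 h2) (transitionMatrix_pow_mul_le M b m n q r q')).ne'

theorem Reachable.trans {M : DFA ℕ Q} {b n : ℕ} {q r : Q} (hq : Reachable M b q)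
    (h : (M.transitionMatrix b ^ n) q r ≠ 0) : Reachable M b r :=
  let ⟨k, hk⟩ := hq
  ⟨k + n, transitionMatrix_pow_add_ne_zero hk h⟩

theorem Coreachable.trans {M : DFA ℕ Q} {b n : ℕ} {q r : Q} (hr : Coreachable M b r)
    (h : (M.transitionMatrix b ^ n) q r ≠ 0) : Coreachable M b q :=
  let ⟨k, q', hq', hk⟩ := hr
  ⟨n + k, q', hq', transitionMatrix_pow_add_ne_zero h hk⟩

theorem Recognizes.transitionMatrix_pow_start_le (hM : S.Recognizes M) {n : ℕ} {q : Q}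
    (hq : q ∈ M.accept) :
    (M.transitionMatrix S.alphabetSize ^ n) M.start q ≤ S.U n := by
  classical
  rw [← hM.sum_transitionMatrix_pow n]
  refine le_trans (by rw [if_pos hq, mul_one]) (Finset.single_le_sum
    (f := fun q' => (M.transitionMatrix S.alphabetSize ^ n) M.start q' *
      (if q' ∈ M.accept then (1 : ℝ) else 0)) (fun a _ => mul_nonneg
    (transitionMatrix_pow_nonneg _ _ _ _ _) (by split_ifs <;> norm_num)) (Finset.mem_univ q))

/-- A fixed path from the start to `q` and one from `q'` to acceptance extend each path to an
accepted one; the extra length costs a bounded factor of `U`. -/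
theorem Recognizes.exists_transitionMatrix_pow_le (hM : S.Recognizes M) :
    ∃ C : ℝ, 0 ≤ C ∧ ∀ q q', Reachable M S.alphabetSize q → Coreachable M S.alphabetSize q' →
      ∀ n, (M.transitionMatrix S.alphabetSize ^ n) q q' ≤ C * S.U n := by
  classical
  obtain ⟨R, -, hR⟩ := S.exists_ratio_bound
  have key : ∀ x : Q × Q, ∃ C : ℝ, 0 ≤ C ∧ (Reachable M S.alphabetSize x.1 →
      Coreachable M S.alphabetSize x.2 →
      ∀ n, (M.transitionMatrix S.alphabetSize ^ n) x.1 x.2 ≤ C * S.U n) := by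
    rintro ⟨q, q'⟩
    by_cases hq : Reachable M S.alphabetSize q
    swap
    · exact ⟨0, le_rfl, fun h => absurd h hq⟩
    by_cases hq' : Coreachable M S.alphabetSize q'
    swap
    · exact ⟨0, le_rfl, fun _ h => absurd h hq'⟩
    obtain ⟨k, hk⟩ := hq
    obtain ⟨l, f, hf, hl⟩ := hq'
    have h1 := lt_of_le_of_ne (transitionMatrix_pow_nonneg M _ k _ q) hk.symm
    have h2 := lt_of_le_of_ne (transitionMatrix_pow_nonneg M _ l q' f) hl.symm
    set x := (M.transitionMatrix S.alphabetSize ^ k) M.start q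
    set y := (M.transitionMatrix S.alphabetSize ^ l) q' f
    refine ⟨R ^ (k + l) / (x * y), by positivity, fun _ _ n => ?_⟩
    have h3 : x * (M.transitionMatrix S.alphabetSize ^ n) q q' * y ≤ S.U (k + n + l) :=
      calc _ ≤ (M.transitionMatrix S.alphabetSize ^ (k + n)) M.start q' * y :=
            mul_le_mul_of_nonneg_right (transitionMatrix_pow_mul_le M _ k n _ _ _) h2.le
        _ ≤ (M.transitionMatrix S.alphabetSize ^ (k + n + l)) M.start f :=
            transitionMatrix_pow_mul_le M _ (k + n) l _ _ _
        _ ≤ _ := hM.transitionMatrix_pow_start_le hf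
    have h4 : (S.U (k + n + l) : ℝ) ≤ R ^ (k + l) * S.U n := by
      have := U_add_le_of_ratio_bound hR n (k + l)
      rw [show n + (k + l) = k + n + l by ring] at this
      exact_mod_cast this
    dsimp only
    rw [div_mul_eq_mul_div, le_div_iff₀ (mul_pos h1 h2)]
    linarith
  choose C hC0 hC using key
  refine ⟨∑ x, C x, Finset.sum_nonneg fun x _ => hC0 x, fun q q' hq hq' n => ?_⟩
  refine (hC (q, q') hq hq' n).trans (mul_le_mul_of_nonneg_right ?_ (Nat.cast_nonneg _))
  exact Finset.single_le_sum (fun x _ => hC0 x) (Finset.mem_univ _)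

/-- An accepted path cut at time `m` passes through a reachable and coreachable state, so both
halves are bounded. -/
theorem Recognizes.exists_U_add_le (hM : S.Recognizes M) :
    ∃ C : ℝ, 0 < C ∧ ∀ m n, (S.U (m + n) : ℝ) ≤ C * (S.U m * S.U n) := by
  classical
  obtain ⟨C, hC0, hC⟩ := hM.exists_transitionMatrix_pow_le
  refine ⟨∑ _q : Q, ∑ _r : Q, C * C + 1, by positivity, fun m n => ?_⟩
  have h1 : (S.U (m + n) : ℝ) ≤ ∑ q' : Q, ∑ _r : Q, C * C * (S.U m * S.U n) := by
    rw [← hM.sum_transitionMatrix_pow (m + n)]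
    refine Finset.sum_le_sum fun q' _ => ?_
    split_ifs with hq'
    · rw [mul_one, pow_add, Matrix.mul_apply]
      refine Finset.sum_le_sum fun r _ => ?_
      have hpos : 0 ≤ C * C * ((S.U m : ℝ) * S.U n) := by positivity
      by_cases h0 : (M.transitionMatrix S.alphabetSize ^ m) M.start r = 0
      · rw [h0, zero_mul]; exact hpos
      by_cases h0' : (M.transitionMatrix S.alphabetSize ^ n) r q' = 0
      · rw [h0', mul_zero]; exact hpos
      have hr : Reachable M S.alphabetSize r := ⟨m, h0⟩
      have hr' : Coreachable M S.alphabetSize r := ⟨n, q', hq', h0'⟩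
      calc _ ≤ (C * S.U m) * (C * S.U n) :=
            mul_le_mul (hC _ _ (reachable_start M _) hr' m)
              (hC _ _ hr (coreachable_of_mem_accept _ hq') n)
              (transitionMatrix_pow_nonneg _ _ _ _ _) (by positivity)
        _ = _ := by ring
    · rw [mul_zero]; positivity
  refine h1.trans (le_of_le_of_eq (b := (∑ _q : Q, ∑ _r : Q, C * C) * (S.U m * S.U n)) ?_ ?_ |>.trans
    (mul_le_mul_of_nonneg_right (le_add_of_nonneg_right zero_le_one) (by positivity)))
  · simp only [Finset.sum_mul]; exact le_rfl
  · rfl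

open Classical in
/-- The transition matrix restricted to the useful part of the automaton. -/
noncomputable def trimMatrix (M : DFA ℕ Q) (b : ℕ) : Matrix Q Q ℝ := fun q q' =>
  if Reachable M b q ∧ Coreachable M b q' then M.transitionMatrix b q q' else 0

/-- Every state on such a path is itself reachable and coreachable. Trimming discards only the
entries whose growth `U` does not control. -/
theorem trimMatrix_pow_apply {M : DFA ℕ Q} {b : ℕ} {q q' : Q} (hq : Reachable M b q)
    (hq' : Coreachable M b q') (n : ℕ) :
    (trimMatrix M b ^ n) q q' = (M.transitionMatrix b ^ n) q q' := by
  induction n generalizing q' with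
  | zero => simp
  | succ n ih =>
    rw [pow_succ, pow_succ, Matrix.mul_apply, Matrix.mul_apply]
    refine Finset.sum_congr rfl fun r _ => ?_
    by_cases h0 : M.transitionMatrix b r q' = 0
    · rw [h0, trimMatrix, h0, ite_self, mul_zero, mul_zero]
    have hr : Coreachable M b r := hq'.trans (n := 1) (by rwa [pow_one])
    rw [ih hr]
    by_cases h1 : (M.transitionMatrix b ^ n) q r = 0
    · rw [h1, zero_mul, zero_mul]
    · rw [trimMatrix, if_pos ⟨hq.trans h1, hq'⟩]

theorem trimMatrix_pow_succ_eq_zero {M : DFA ℕ Q} {b : ℕ} {q q' : Q}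
    (h : ¬(Reachable M b q ∧ Coreachable M b q')) (n : ℕ) :
    (trimMatrix M b ^ (n + 1)) q q' = 0 := by
  by_cases hq : Reachable M b q
  · have hq' : ¬Coreachable M b q' := fun h' => h ⟨hq, h'⟩
    rw [pow_succ, Matrix.mul_apply]
    refine Finset.sum_eq_zero fun r _ => ?_
    rw [trimMatrix, if_neg (fun h => hq' h.2), mul_zero]
  · rw [pow_succ', Matrix.mul_apply]
    refine Finset.sum_eq_zero fun r _ => ?_
    rw [trimMatrix, if_neg (fun h => hq h.1), zero_mul]

/-- If `U` has exact exponential growth, then its normalization converges along arithmetic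
progressions. -/
theorem Recognizes.exists_tendsto_div_pow (hM : S.Recognizes M) {l c : ℝ} (hl : 0 < l)
    (hU : ∀ n, (S.U n : ℝ) ≤ c * l ^ n) :
    ∃ D : ℕ, 0 < D ∧ ∀ j, ∃ y : ℝ,
      Tendsto (fun n => (S.U (D * n + j) : ℝ) / l ^ (D * n + j)) atTop (𝓝 y) := by
  classical
  obtain ⟨C, hC0, hC⟩ := hM.exists_transitionMatrix_pow_le
  set T := trimMatrix M S.alphabetSize with hT
  have hpow : ∀ n q q', ((l⁻¹ • T) ^ n) q q' = (T ^ n) q q' / l ^ n := by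
    intro n q q'
    rw [smul_pow, Matrix.smul_apply, smul_eq_mul, inv_pow, div_eq_inv_mul]
  have hbd : ∀ n q q', ((l⁻¹ • T) ^ n) q q' ≤ C * c + 1 := by
    have hCc : 0 ≤ C * c := by
      have := hU 0
      rw [pow_zero, mul_one] at this
      exact mul_nonneg hC0 ((Nat.cast_nonneg _).trans this)
    intro n q q'
    cases n with
    | zero =>
      rw [pow_zero, Matrix.one_apply]
      split_ifs <;> linarith
    | succ n =>
      rw [hpow]
      by_cases h : Reachable M S.alphabetSize q ∧ Coreachable M S.alphabetSize q'
      · rw [hT, trimMatrix_pow_apply h.1 h.2, div_le_iff₀ (pow_pos hl _)]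
        have h1 := hC q q' h.1 h.2 (n + 1)
        have h2 := mul_le_mul_of_nonneg_left (hU (n + 1)) hC0
        have h3 := pow_pos hl (n + 1)
        nlinarith
      · rw [hT, trimMatrix_pow_succ_eq_zero h, zero_div]
        linarith
  have h0 : ∀ q q', 0 ≤ (l⁻¹ • T) q q' := by
    intro q q'
    rw [Matrix.smul_apply, smul_eq_mul, hT, trimMatrix]
    refine mul_nonneg (inv_nonneg.2 hl.le) ?_
    split_ifs
    · exact transitionMatrix_nonneg M _ q q'
    · exact le_rfl
  obtain ⟨D, hD, e, he⟩ := Matrix.exists_tendsto_pow_mul h0 hbd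
  refine ⟨D, hD, fun j => ?_⟩
  have hsum : ∀ n, (S.U n : ℝ) / l ^ n =
      ∑ q', ((l⁻¹ • T) ^ n) M.start q' * (if q' ∈ M.accept then 1 else 0) := by
    intro n
    rw [← hM.sum_transitionMatrix_pow n, Finset.sum_div]
    refine Finset.sum_congr rfl fun q' _ => ?_
    split_ifs with h
    · rw [hpow, hT, trimMatrix_pow_apply (reachable_start M _) (coreachable_of_mem_accept _ h),
        mul_one, mul_one]
    · simp
  have hej : Tendsto (fun n => (l⁻¹ • T) ^ (D * n + j)) atTop (𝓝 (e * (l⁻¹ • T) ^ j)) := by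
    simp only [pow_add]
    exact he.mul_const _
  have hlim := tendsto_finsetSum Finset.univ fun q' _ =>
    (tendsto_pi_nhds.1 (tendsto_pi_nhds.1 hej M.start) q').mul_const
      (if q' ∈ M.accept then (1 : ℝ) else 0)
  exact ⟨_, hlim.congr fun n => (hsum (D * n + j)).symm⟩

end Trim

/-! ### Supermultiplicativity and convergence of the quotients -/

section Growth

variable {Q : Type} {M : DFA ℕ Q}

theorem U_le_sum_maxDigit_add (S : PositionalSystem) {N n : ℕ} (hN : N ≤ n) :
    S.U n ≤ ∑ k ∈ Finset.range (n - N), S.maxDigit n k * S.U (n - 1 - k) + S.U N := by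
  have h1 := S.sum_maxDigit_add_maxRem n (n - N)
  have h2 := S.maxRem_lt (n := n) (k := n - N) (Nat.sub_le _ _)
  rw [Nat.sub_sub_self hN] at h2
  omega

theorem sum_maxDigit_le (S : PositionalSystem) (n t : ℕ) :
    ∑ k ∈ Finset.range t, S.maxDigit n k * S.U (n - 1 - k) ≤ S.U n := by
  have h1 := S.sum_maxDigit_add_maxRem n t
  omega

/-- If the greedy representations of the numbers `U_n - 1` have the form `1 0 ⋯ 0 w` with `w` of
bounded length, then the quotients of consecutive terms tend to `1`. -/
theorem tendsto_ratio_one {N : ℕ}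
    (h : ∀ n, ∑ k ∈ Finset.range (n - N), S.maxDigit n k ≤ 1) :
    Tendsto (fun n => (S.U (n + 1) : ℝ) / S.U n) atTop (𝓝 1) := by
  have hle : ∀ n, N ≤ n → S.U (n + 1) ≤ S.U n + S.U N := by
    intro n hn
    have h1 := S.U_le_sum_maxDigit_add (show N ≤ n + 1 by omega)
    have h2 : ∑ k ∈ Finset.range (n + 1 - N), S.maxDigit (n + 1) k * S.U (n + 1 - 1 - k) ≤
        ∑ k ∈ Finset.range (n + 1 - N), S.maxDigit (n + 1) k * S.U n :=
      Finset.sum_le_sum fun k _ =>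
        Nat.mul_le_mul_left _ (S.increasing.monotone (by omega))
    rw [← Finset.sum_mul] at h2
    have h3 := Nat.mul_le_mul_right (S.U n) (h (n + 1))
    omega
  have hinf : Tendsto (fun n => (S.U n : ℝ)) atTop atTop :=
    tendsto_natCast_atTop_atTop.comp S.increasing.tendsto_atTop
  have hup : Tendsto (fun n => 1 + (S.U N : ℝ) / S.U n) atTop (𝓝 (1 + 0)) :=
    (hinf.const_div_atTop _).const_add 1
  rw [add_zero] at hup
  refine tendsto_of_tendsto_of_tendsto_of_le_of_le' tendsto_const_nhds hup ?_ ?_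
  · refine Eventually.of_forall fun n => ?_
    have hpos : (0 : ℝ) < S.U n := by exact_mod_cast S.U_pos n
    rw [le_div_iff₀ hpos, one_mul]
    exact_mod_cast (S.increasing n.lt_succ_self).le
  · filter_upwards [eventually_ge_atTop N] with n hn
    have hpos : (0 : ℝ) < S.U n := by exact_mod_cast S.U_pos n
    rw [div_le_iff₀ hpos, add_mul, one_mul, div_mul_cancel₀ _ hpos.ne']
    exact_mod_cast hle n hn

/-- By periodicity of the digits, `U_n` and `U_{n+cP}` satisfy the same recurrence up to an error
`U_N`, so induction compares `U_{cP} U_n` with `U_{n+cP}`. The correction `E` absorbs the error; a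
digit sum of at least 2 once per period makes it possible. -/
theorem Recognizes.exists_mul_U_le_U_add (hM : S.Recognizes M) {N P : ℕ} (hP0 : 0 < P)
    (hP : ∀ m, N ≤ m → M.live (m + P) = M.live m) {n₁ : ℕ}
    (h2 : 2 ≤ ∑ k ∈ Finset.range (n₁ - N), S.maxDigit n₁ k) :
    ∃ C : ℕ, 0 < C ∧ ∀ m n, S.U m * S.U n ≤ C * S.U (m + n) := by
  have hn₁ : N < n₁ := by
    by_contra hle
    rw [Nat.sub_eq_zero_of_le (not_lt.1 hle)] at h2
    simp at h2
  -- `t n` is the residue of `n - n₁` mod `P`. `E` drops by `U_N` at each step, where the leading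
  -- digit suffices, and is reset when `t n = 0`, where the digit sum 2 pays for it.
  set t : ℕ → ℕ := fun n => (n + (P - 1) * n₁) % P with ht
  set E : ℕ → ℕ := fun n => S.U N * (2 * P - t n) with hE
  have htlt : ∀ n, t n < P := fun n => Nat.mod_lt _ hP0
  have ht1 : n₁ + (P - 1) * n₁ = P * n₁ := by
    obtain ⟨p, rfl⟩ : ∃ p, P = p + 1 := ⟨P - 1, by omega⟩
    rw [Nat.add_sub_cancel]; ring
  have hElow : ∀ n, S.U N * (P + 1) ≤ E n := fun n =>
    Nat.mul_le_mul_left _ (by have := htlt n; omega)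
  have hEup : ∀ n, E n ≤ S.U N * (2 * P) := fun n => Nat.mul_le_mul_left _ (Nat.sub_le _ _)
  have hEstep : ∀ n, n₁ ≤ n →
      S.U N + E n ≤ ∑ k ∈ Finset.range (n - N), S.maxDigit n k * E (n - 1 - k) := by
    intro n hn
    by_cases h0 : t n = 0
    · have hdvd : P ∣ n - n₁ := by
        have h1 : P ∣ n + (P - 1) * n₁ := Nat.dvd_of_mod_eq_zero h0
        have h3 := Nat.dvd_sub h1 (Dvd.intro n₁ rfl : P ∣ P * n₁)
        rwa [← ht1, Nat.add_sub_add_right] at h3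
      obtain ⟨c, hc⟩ := hdvd
      have hnc : n = n₁ + c * P := by rw [mul_comm c P]; omega
      have hsum : 2 ≤ ∑ k ∈ Finset.range (n - N), S.maxDigit n k := by
        refine h2.trans ?_
        rw [Finset.sum_congr rfl fun k hk => (hM.maxDigit_add_mul_period hP
          (by have := Finset.mem_range.1 hk; omega) c).symm, ← hnc]
        exact Finset.sum_le_sum_of_subset (Finset.range_mono (by omega))
      calc S.U N + E n ≤ 2 * (S.U N * (P + 1)) := by have := hEup n; nlinarith
        _ ≤ (∑ k ∈ Finset.range (n - N), S.maxDigit n k) * (S.U N * (P + 1)) :=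
            Nat.mul_le_mul_right _ hsum
        _ ≤ _ := by
            rw [Finset.sum_mul]
            exact Finset.sum_le_sum fun k _ => Nat.mul_le_mul_left _ (hElow _)
    · have hts : t n = t (n - 1) + 1 := by
        have h3 : n + (P - 1) * n₁ = (n - 1 + (P - 1) * n₁) + 1 := by omega
        simp only [ht] at h0 ⊢
        rw [h3] at h0 ⊢
        rw [Nat.add_mod] at h0 ⊢
        have hlt := Nat.mod_lt (n - 1 + (P - 1) * n₁) hP0
        set z := (n - 1 + (P - 1) * n₁) % P
        rcases Nat.lt_or_ge 1 P with h1P | h1P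
        · rw [Nat.mod_eq_of_lt h1P] at h0 ⊢
          rcases Nat.lt_or_ge (z + 1) P with hz | hz
          · exact Nat.mod_eq_of_lt hz
          · exact absurd (by rw [show z + 1 = P by omega, Nat.mod_self]) h0
        · exact absurd (by rw [show P = 1 by omega, Nat.mod_one]) h0
      have hEn : S.U N + E n = E (n - 1) := by
        simp only [hE]
        have := htlt n
        rw [hts] at this ⊢
        rw [show 2 * P - t (n - 1) = 1 + (2 * P - (t (n - 1) + 1)) by omega, mul_add, mul_one]
      rw [hEn]
      calc E (n - 1) ≤ S.maxDigit n 0 * E (n - 1 - 0) :=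
            Nat.le_mul_of_pos_left _ (S.one_le_maxDigit_zero (by omega))
        _ ≤ _ := Finset.single_le_sum (f := fun k => S.maxDigit n k * E (n - 1 - k))
            (fun _ _ => Nat.zero_le _) (Finset.mem_range.2 (by omega))
  have hmain : ∀ c n, S.U (c * P) * (S.U n + E n) ≤
      (S.U n₁ + S.U N * (2 * P)) * S.U (n + c * P) := by
    intro c n
    induction n using Nat.strong_induction_on with
    | _ n ih =>
      rcases Nat.lt_or_ge n n₁ with hn | hn
      · rw [mul_comm]
        exact Nat.mul_le_mul (Nat.add_le_add (S.increasing.monotone hn.le) (hEup n))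
          (S.increasing.monotone (Nat.le_add_left _ _))
      · have h3 : S.U n + E n ≤
            ∑ k ∈ Finset.range (n - N), S.maxDigit n k * (S.U (n - 1 - k) + E (n - 1 - k)) := by
          have := S.U_le_sum_maxDigit_add (show N ≤ n by omega)
          have := hEstep n hn
          simp only [mul_add, Finset.sum_add_distrib]
          omega
        calc _ ≤ S.U (c * P) * ∑ k ∈ Finset.range (n - N),
              S.maxDigit n k * (S.U (n - 1 - k) + E (n - 1 - k)) := Nat.mul_le_mul_left _ h3
          _ = ∑ k ∈ Finset.range (n - N),
              S.maxDigit n k * (S.U (c * P) * (S.U (n - 1 - k) + E (n - 1 - k))) := by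
              rw [Finset.mul_sum]
              exact Finset.sum_congr rfl fun k _ => by ring
          _ ≤ ∑ k ∈ Finset.range (n - N), S.maxDigit n k *
              ((S.U n₁ + S.U N * (2 * P)) * S.U (n - 1 - k + c * P)) :=
              Finset.sum_le_sum fun k _ => Nat.mul_le_mul_left _ (ih _ (by omega))
          _ = (S.U n₁ + S.U N * (2 * P)) * ∑ k ∈ Finset.range (n - N),
              S.maxDigit (n + c * P) k * S.U (n + c * P - 1 - k) := by
              rw [Finset.mul_sum]
              refine Finset.sum_congr rfl fun k hk => ?_
              have hk' := Finset.mem_range.1 hk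
              rw [hM.maxDigit_add_mul_period hP (by omega),
                show n + c * P - 1 - k = n - 1 - k + c * P by omega]
              ring
          _ ≤ _ := Nat.mul_le_mul_left _ (S.sum_maxDigit_le _ _)
  -- Rounding `m` down to a multiple of `P` costs a factor at most `R ^ P`.
  obtain ⟨R, hR0, hR⟩ := S.exists_ratio_bound
  refine ⟨R ^ P * (S.U n₁ + S.U N * (2 * P)),
    Nat.mul_pos (pow_pos hR0 _) (Nat.add_pos_left (S.U_pos _) _), fun m n => ?_⟩
  have hm : S.U m ≤ R ^ P * S.U (m / P * P) := by
    have h3 := U_add_le_of_ratio_bound hR (m / P * P) (m % P)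
    rw [Nat.div_add_mod'] at h3
    exact h3.trans (Nat.mul_le_mul_right _
      (Nat.pow_le_pow_right hR0 (Nat.mod_lt _ hP0).le))
  calc S.U m * S.U n ≤ R ^ P * S.U (m / P * P) * (S.U n + E n) :=
        Nat.mul_le_mul hm (Nat.le_add_right _ _)
    _ = R ^ P * (S.U (m / P * P) * (S.U n + E n)) := mul_assoc _ _ _
    _ ≤ R ^ P * ((S.U n₁ + S.U N * (2 * P)) * S.U (n + m / P * P)) :=
        Nat.mul_le_mul_left _ (hmain _ _)
    _ ≤ R ^ P * ((S.U n₁ + S.U N * (2 * P)) * S.U (m + n)) :=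
        Nat.mul_le_mul_left _ (Nat.mul_le_mul_left _ (S.increasing.monotone
          (by have := Nat.div_mul_le_self m P; omega)))
    _ = _ := by ring

/-- Sub- and supermultiplicativity up to constants give exact exponential growth. -/
theorem exists_exponential_growth {C₁ : ℝ} {C₂ : ℕ} (hC₁ : 0 < C₁) (hC₂ : 0 < C₂)
    (h₁ : ∀ m n, (S.U (m + n) : ℝ) ≤ C₁ * (S.U m * S.U n))
    (h₂ : ∀ m n, S.U m * S.U n ≤ C₂ * S.U (m + n)) :
    ∃ l : ℝ, 0 < l ∧ ∃ c : ℝ, 0 < c ∧ ∀ n, (S.U n : ℝ) ≤ c * l ^ n ∧ c⁻¹ * l ^ n ≤ S.U n := by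
  obtain ⟨R, hR0, hR⟩ := S.exists_ratio_bound
  have hpos : ∀ n, (0 : ℝ) < S.U n := fun n => by exact_mod_cast S.U_pos n
  have hC₂' : (0 : ℝ) < C₂ := by exact_mod_cast hC₂
  have hR' : (0 : ℝ) < R := by exact_mod_cast hR0
  obtain ⟨L, hL⟩ := exists_abs_sub_mul_le_of_quasiadditive (x := fun n => Real.log (S.U n))
    (c := max (Real.log C₁) (Real.log C₂)) (K := Real.log R)
    (fun n => Real.log_nonneg (by exact_mod_cast S.U_pos n))
    (fun n => by
      rw [← Real.log_pow]
      refine Real.log_le_log (hpos n) ?_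
      have := U_add_le_of_ratio_bound hR 0 n
      rw [S.zero_eq_one, zero_add, mul_one] at this
      exact_mod_cast this)
    (fun m n => by
      have e1 : Real.log (S.U (m + n)) ≤ Real.log C₁ + (Real.log (S.U m) + Real.log (S.U n)) := by
        rw [← Real.log_mul (hpos m).ne' (hpos n).ne', ← Real.log_mul hC₁.ne'
          (mul_pos (hpos m) (hpos n)).ne']
        exact Real.log_le_log (hpos _) (h₁ m n)
      have e2 : Real.log (S.U m) + Real.log (S.U n) ≤ Real.log C₂ + Real.log (S.U (m + n)) := by
        rw [← Real.log_mul (hpos m).ne' (hpos n).ne', ← Real.log_mul hC₂'.ne' (hpos _).ne']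
        exact Real.log_le_log (mul_pos (hpos m) (hpos n)) (by exact_mod_cast h₂ m n)
      rw [abs_le]
      constructor
      · linarith [le_max_right (Real.log C₁) (Real.log C₂)]
      · linarith [le_max_left (Real.log C₁) (Real.log C₂)])
  refine ⟨Real.exp L, Real.exp_pos L, Real.exp (max (Real.log C₁) (Real.log C₂)),
    Real.exp_pos _, fun n => ?_⟩
  have hn := abs_le.1 (hL n)
  rw [← Real.exp_nat_mul, ← Real.exp_add, ← Real.exp_neg, ← Real.exp_add]
  constructor
  · rw [← Real.log_le_iff_le_exp (hpos n)]
    linarith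
  · rw [← Real.le_log_iff_exp_le (hpos n)]
    linarith

/-- If the numeration language is regular, then the quotients of consecutive terms converge along
arithmetic progressions. -/
theorem exists_tendsto_ratio (hS : S.numerationLanguage.IsRegular) :
    ∃ D : ℕ, 0 < D ∧ ∀ j, ∃ y : ℝ,
      Tendsto (fun n => (S.U (D * n + j + 1) : ℝ) / S.U (D * n + j)) atTop (𝓝 y) := by
  classical
  obtain ⟨Q, _, M, hM⟩ := exists_recognizes hS
  obtain ⟨N, P, hP0, hP⟩ := M.exists_live_periodic
  -- In the first case growth is at most linear and supermultiplicativity fails, so it needs a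
  -- separate argument.
  by_cases hcase : ∀ n, ∑ k ∈ Finset.range (n - N), S.maxDigit n k ≤ 1
  · refine ⟨1, one_pos, fun j => ⟨1, ?_⟩⟩
    refine ((tendsto_ratio_one hcase).comp (tendsto_add_atTop_nat j)).congr fun n => ?_
    rw [one_mul]
    rfl
  · push Not at hcase
    obtain ⟨n₁, hn₁⟩ := hcase
    obtain ⟨C₁, hC₁, h₁⟩ := hM.exists_U_add_le
    obtain ⟨C₂, hC₂, h₂⟩ := hM.exists_mul_U_le_U_add hP0 hP hn₁
    obtain ⟨l, hl, c, hc, hU⟩ := exists_exponential_growth hC₁ hC₂ h₁ h₂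
    obtain ⟨D, hD, hlim⟩ := hM.exists_tendsto_div_pow hl fun n => (hU n).1
    refine ⟨D, hD, fun j => ?_⟩
    obtain ⟨y, hy⟩ := hlim j
    obtain ⟨y', hy'⟩ := hlim (j + 1)
    have hy0 : y ≠ 0 := by
      have : c⁻¹ ≤ y := ge_of_tendsto' hy fun n => by
        rw [le_div_iff₀ (pow_pos hl _)]
        exact (hU _).2
      exact ((inv_pos.2 hc).trans_le this).ne'
    refine ⟨l * (y' / y), ((hy'.div hy hy0).const_mul l).congr fun n => ?_⟩
    have h1 : (S.U (D * n + j) : ℝ) ≠ 0 := by exact_mod_cast (S.U_pos _).ne'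
    have h2 : l ^ (D * n + j) ≠ 0 := (pow_pos hl _).ne'
    rw [Pi.div_apply, ← add_assoc, pow_succ]
    field_simp

end Growth

end PositionalSystem

/-! ### Periodicity of quasi-greedy expansions -/

namespace AlternateBase

variable (B : AlternateBase)

theorem seq_congr {m n : ℕ} (h : m % B.p = n % B.p) : B.seq m = B.seq n := by
  simp only [seq, h]

theorem d_congr {i j : ℕ} (h : i % B.p = j % B.p) : B.d i = B.d j := by
  have : (fun n => B.seq (i + n)) = fun n => B.seq (j + n) :=
    funext fun n => B.seq_congr (Nat.ModEq.add_right n h)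
  rw [d, d, this]

theorem quasiGreedy_add_len {i : ℕ} (h : EndsInZeros (B.d i)) (n : ℕ) :
    B.quasiGreedy i (n + B.len i) = B.quasiGreedy (i + B.len i) n := by
  rw [quasiGreedy, dif_pos h, if_neg (by omega)]
  by_cases h1 : n + B.len i + 1 = B.len i
  · omega
  · rw [if_neg h1, Nat.add_sub_cancel]

theorem quasiGreedy_of_not_endsInZeros {i : ℕ} (h : ¬EndsInZeros (B.d i)) (n : ℕ) :
    B.quasiGreedy i n = B.d i n := by
  rw [quasiGreedy, dif_neg h]

theorem quasiGreedy_congr {i j : ℕ} (h : i % B.p = j % B.p) (n : ℕ) :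
    B.quasiGreedy i n = B.quasiGreedy j n := by
  induction n using Nat.strong_induction_on generalizing i j with
  | _ n ih =>
    have hd := B.d_congr h
    have hl : B.len i = B.len j := by rw [len, len, hd]
    rw [quasiGreedy.eq_def B i n, quasiGreedy.eq_def B j n]
    simp only [hd, hl]
    by_cases hz : EndsInZeros (B.d j)
    · have hpos := B.len_pos j hz
      rw [dif_pos (show EndsInZeros (B.d i) by rwa [hd]), dif_pos hz]
      split_ifs
      · rfl
      · rfl
      · exact ih _ (by omega) (Nat.ModEq.add_right _ h)
    · rw [dif_neg (show ¬EndsInZeros (B.d i) by rwa [hd]), dif_neg hz]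

/-- The starting points of the successive blocks of the quasi-greedy expansion. -/
noncomputable def blockStart (i : ℕ) : ℕ → ℕ
  | 0 => 0
  | t + 1 => blockStart i t + B.len (i + blockStart i t)

/-- Either some block is infinite and supplies the tail, or all blocks are finite and two of them
start at congruent positions mod `p`, after which the word repeats. -/
theorem ultimatelyPeriodic_quasiGreedy
    (h : ∀ i, ¬EndsInZeros (B.d i) → UltimatelyPeriodic (B.d i)) (i : ℕ) :
    UltimatelyPeriodic (B.quasiGreedy i) := by
  by_cases hex : ∃ t, ¬EndsInZeros (B.d (i + B.blockStart i t)) ∧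
      ∀ n, B.quasiGreedy i (n + B.blockStart i t) = B.quasiGreedy (i + B.blockStart i t) n
  · obtain ⟨t, ht, hshift⟩ := hex
    obtain ⟨q, m, hm, hper⟩ := h _ ht
    refine ⟨q + B.blockStart i t, m, hm, fun n hn => ?_⟩
    obtain ⟨k, rfl⟩ := Nat.exists_eq_add_of_le' (show B.blockStart i t ≤ n by omega)
    rw [show k + B.blockStart i t + m = k + m + B.blockStart i t by ring, hshift, hshift,
      B.quasiGreedy_of_not_endsInZeros ht, B.quasiGreedy_of_not_endsInZeros ht]
    exact hper k (by omega)
  · have hfin : ∀ t, (∀ n, B.quasiGreedy i (n + B.blockStart i t) =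
        B.quasiGreedy (i + B.blockStart i t) n) → EndsInZeros (B.d (i + B.blockStart i t)) := by
      intro t ht
      by_contra hne
      exact hex ⟨t, hne, ht⟩
    have hshift : ∀ t n, B.quasiGreedy i (n + B.blockStart i t) =
        B.quasiGreedy (i + B.blockStart i t) n := by
      intro t
      induction t with
      | zero => intro n; rfl
      | succ t ih =>
        intro n
        rw [blockStart, add_comm (B.blockStart i t), ← add_assoc, ih,
          B.quasiGreedy_add_len (hfin t ih), add_comm (B.len _), ← add_assoc]
    have hmono : StrictMono (B.blockStart i) := strictMono_nat_of_lt_succ fun t => by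
      have := B.len_pos _ (hfin t (hshift t))
      rw [blockStart]
      omega
    obtain ⟨a, b, hab, hmod⟩ := Finite.exists_ne_map_eq_of_infinite
      (fun t => (⟨B.blockStart i t % B.p, Nat.mod_lt _ B.p_pos⟩ : Fin B.p))
    wlog hlt : a < b generalizing a b
    · exact this b a hab.symm hmod.symm (lt_of_le_of_ne (not_lt.1 hlt) hab.symm)
    have hmod' : B.blockStart i b % B.p = B.blockStart i a % B.p := (Fin.ext_iff.1 hmod).symm
    have hlt' := hmono hlt
    refine ⟨B.blockStart i a, B.blockStart i b - B.blockStart i a, by omega, fun n hn => ?_⟩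
    obtain ⟨k, rfl⟩ := Nat.exists_eq_add_of_le' hn
    rw [show k + B.blockStart i a + (B.blockStart i b - B.blockStart i a) =
      k + B.blockStart i b by omega, hshift, hshift]
    exact B.quasiGreedy_congr (Nat.ModEq.add_left i hmod') k

end AlternateBase

theorem greedyRemainder_eq_zero_of_le {β : ℕ → ℝ} {x : ℝ} {k n : ℕ}
    (h : greedyRemainder β x k = 0) (hn : k ≤ n) : greedyRemainder β x n = 0 := by
  induction n, hn using Nat.le_induction with
  | base => exact h
  | succ n _ ih => rw [greedyRemainder, ih, mul_zero, Int.fract_zero]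

theorem greedyRemainder_ne_zero_of_not_endsInZeros {β : ℕ → ℝ} {x : ℝ}
    (h : ¬EndsInZeros (greedyExpansion β x)) (k : ℕ) : greedyRemainder β x k ≠ 0 := by
  intro h0
  refine h ⟨k, fun n hn => ?_⟩
  rw [greedyExpansion, greedyRemainder_eq_zero_of_le h0 hn, mul_zero, Nat.floor_zero]

/-! ### Digits of `U_n - 1` and expansions of 1 -/

namespace PositionalSystem

variable {S : PositionalSystem} {B : AlternateBase}

theorem HasAssociatedBase.tendsto_seq (hB : S.HasAssociatedBase B) (i : ℕ) :
    Tendsto (fun n : ℕ => (S.U (n * B.p - i) : ℝ) / S.U (n * B.p - i - 1)) atTop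
      (𝓝 (B.seq i)) := by
  have h := (hB ⟨i % B.p, Nat.mod_lt _ B.p_pos⟩).comp (tendsto_sub_atTop_nat (i / B.p))
  refine h.congr' ?_
  filter_upwards [eventually_ge_atTop (i / B.p)] with n hn
  have : (n - i / B.p) * B.p - i % B.p = n * B.p - i := by
    have h1 := Nat.div_add_mod' i B.p
    rw [Nat.sub_mul]
    omega
  simp only [Function.comp_apply, this]

theorem tendsto_mul_sub_atTop {p : ℕ} (hp : 0 < p) (i : ℕ) :
    Tendsto (fun n : ℕ => n * p - i) atTop atTop :=
  (tendsto_sub_atTop_nat i).comp (tendsto_id.atTop_mul_const' hp)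

/-- Divided by terms of `U`, the greedy algorithm on `U_{np-i} - 1` tends to that on 1. Passing to
the limit needs continuity of the fractional part, hence non-integer values; these are ensured
because an infinite `d_i` has no zero remainder. -/
theorem HasAssociatedBase.tendsto_maxRem (hB : S.HasAssociatedBase B) {i : ℕ}
    (hi : ¬EndsInZeros (B.d i)) (k : ℕ) :
    Tendsto (fun n : ℕ => (S.maxRem (n * B.p - i) k : ℝ) / S.U (n * B.p - i - k)) atTop
      (𝓝 (greedyRemainder (fun n => B.seq (i + n)) 1 k)) ∧
    Tendsto (fun n : ℕ => (S.maxRem (n * B.p - i) k : ℝ) / S.U (n * B.p - i - 1 - k)) atTop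
      (𝓝 (B.seq (i + k) * greedyRemainder (fun n => B.seq (i + n)) 1 k)) := by
  have hidx := tendsto_mul_sub_atTop B.p_pos i
  have hstep : ∀ k, Tendsto (fun n : ℕ => (S.maxRem (n * B.p - i) k : ℝ) /
      S.U (n * B.p - i - k)) atTop (𝓝 (greedyRemainder (fun n => B.seq (i + n)) 1 k)) →
      Tendsto (fun n : ℕ => (S.maxRem (n * B.p - i) k : ℝ) / S.U (n * B.p - i - 1 - k)) atTop
      (𝓝 (B.seq (i + k) * greedyRemainder (fun n => B.seq (i + n)) 1 k)) := by
    intro k hk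
    refine ((hB.tendsto_seq (i + k)).mul hk).congr fun n => ?_
    have h1 : (S.U (n * B.p - i - k) : ℝ) ≠ 0 := by exact_mod_cast (S.U_pos _).ne'
    have h2 : (S.U (n * B.p - i - 1 - k) : ℝ) ≠ 0 := by exact_mod_cast (S.U_pos _).ne'
    rw [show n * B.p - (i + k) = n * B.p - i - k by omega,
      show n * B.p - i - k - 1 = n * B.p - i - 1 - k by omega]
    field_simp
  suffices h : Tendsto (fun n : ℕ => (S.maxRem (n * B.p - i) k : ℝ) /
      S.U (n * B.p - i - k)) atTop (𝓝 (greedyRemainder (fun n => B.seq (i + n)) 1 k)) from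
    ⟨h, hstep k h⟩
  induction k with
  | zero =>
    have hinf : Tendsto (fun n => (S.U n : ℝ)) atTop atTop :=
      tendsto_natCast_atTop_atTop.comp S.increasing.tendsto_atTop
    have h1 : Tendsto (fun n => 1 - 1 / (S.U n : ℝ)) atTop (𝓝 (1 - 0)) :=
      (hinf.const_div_atTop 1).const_sub 1
    rw [sub_zero] at h1
    refine (h1.comp hidx).congr fun n => ?_
    have h2 : (S.U (n * B.p - i) : ℝ) ≠ 0 := by exact_mod_cast (S.U_pos _).ne'
    rw [Function.comp_apply, maxRem, Nat.sub_zero, Nat.cast_sub (S.U_pos _), Nat.cast_one]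
    field_simp
  | succ k ih =>
    have h1 := hstep k ih
    have hfr : Int.fract (B.seq (i + k) * greedyRemainder (fun n => B.seq (i + n)) 1 k) ≠ 0 :=
      greedyRemainder_ne_zero_of_not_endsInZeros hi (k + 1)
    rw [greedyRemainder]
    have hcont := continuousAt_fract (x := B.seq (i + k) *
      greedyRemainder (fun n => B.seq (i + n)) 1 k) fun h => hfr (by
        rw [Int.fract, ← h, sub_self])
    refine (hcont.tendsto.comp h1).congr fun n => ?_
    rw [Function.comp_apply, Int.fract_div_natCast_eq_div_natCast_mod, maxRem,
      show n * B.p - i - (k + 1) = n * B.p - i - 1 - k by omega]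

theorem HasAssociatedBase.eventually_maxDigit_eq (hB : S.HasAssociatedBase B) {i : ℕ}
    (hi : ¬EndsInZeros (B.d i)) (k : ℕ) :
    ∀ᶠ n : ℕ in atTop, S.maxDigit (n * B.p - i) k = B.d i k := by
  have h1 := (hB.tendsto_maxRem hi k).2
  have hfr : Int.fract (B.seq (i + k) * greedyRemainder (fun n => B.seq (i + n)) 1 k) ≠ 0 :=
    greedyRemainder_ne_zero_of_not_endsInZeros hi (k + 1)
  have hy0 : 0 ≤ B.seq (i + k) * greedyRemainder (fun n => B.seq (i + n)) 1 k :=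
    ge_of_tendsto' h1 fun n => by positivity
  change ∀ᶠ n : ℕ in atTop, S.maxDigit (n * B.p - i) k =
    ⌊B.seq (i + k) * greedyRemainder (fun n => B.seq (i + n)) 1 k⌋₊
  set y := B.seq (i + k) * greedyRemainder (fun n => B.seq (i + n)) 1 k
  have hlow : (⌊y⌋₊ : ℝ) < y := by
    refine lt_of_le_of_ne (Nat.floor_le hy0) fun h => hfr ?_
    rw [← h, Int.fract_natCast]
  filter_upwards [h1.eventually (lt_mem_nhds hlow), h1.eventually (gt_mem_nhds (Nat.lt_floor_add_one y))]
    with n hn1 hn2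
  rw [maxDigit, ← Nat.floor_div_eq_div (K := ℝ), Nat.floor_eq_iff (by positivity)]
  exact ⟨hn1.le, hn2⟩

/-- Some state recurs after `P u` and `P v` digits. Adding `(v - u) P` to the total length changes
no leading digit and equalizes the numbers of remaining letters, so the two continuations coincide.
-/
theorem Recognizes.ultimatelyPeriodic_of_eventually_eq {Q : Type} [Finite Q] {M : DFA ℕ Q}
    (hM : S.Recognizes M) {p i : ℕ} (hp : 0 < p) {a : ℕ → ℕ}
    (ha : ∀ k, ∀ᶠ n : ℕ in atTop, S.maxDigit (n * p - i) k = a k) : UltimatelyPeriodic a := by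
  obtain ⟨N, P, hP0, hP⟩ := M.exists_live_periodic
  have hshift : ∀ s c, i ≤ s → (s + c) * P * p - i = s * P * p - i + (c * p) * P := by
    intro s c hs
    have h1 : s ≤ s * P * p := (Nat.le_mul_of_pos_right s hP0).trans (Nat.le_mul_of_pos_right _ hp)
    have h2 : (s + c) * P * p = s * P * p + (c * p) * P := by ring
    omega
  have hlarge : ∀ s, s ≤ s * P * p := fun s =>
    (Nat.le_mul_of_pos_right s hP0).trans (Nat.le_mul_of_pos_right _ hp)
  -- The chosen length leaves at least `N` letters after `P * u` digits, so the state is already the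
  -- stable one.
  obtain ⟨u, v, huv, hst⟩ := Finite.exists_ne_map_eq_of_infinite
    fun u : ℕ => S.maxState M ((P * u + N + i) * P * p - i) (P * u)
  wlog hlt : u < v generalizing u v
  · exact this v u huv.symm hst.symm (lt_of_le_of_ne (not_lt.1 hlt) huv.symm)
  have hstate : ∀ u t, P * u + N + i ≤ t → S.maxState M (t * P * p - i) (P * u) =
      S.maxState M ((P * u + N + i) * P * p - i) (P * u) := by
    intro u t ht
    obtain ⟨c, rfl⟩ := Nat.exists_eq_add_of_le ht
    rw [hshift _ _ (Nat.le_add_left _ _)]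
    refine hM.maxState_add_mul_period hP ?_ _
    have := hlarge (P * u + N + i)
    omega
  have huvP : P * v = P * u + (v - u) * P := by
    rw [mul_comm (v - u), ← mul_add, Nat.add_sub_cancel' hlt.le]
  refine ⟨P * u, (v - u) * P, Nat.mul_pos (by omega) hP0, fun n hn => ?_⟩
  obtain ⟨j, rfl⟩ := Nat.exists_eq_add_of_le hn
  have hev : Tendsto (fun t : ℕ => t * P) atTop atTop := tendsto_id.atTop_mul_const' hP0
  obtain ⟨t, ht1, ht2, ht3⟩ := ((hev.eventually (ha (P * u + j))).and
    ((hev.eventually (ha (P * v + j))).and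
      (eventually_ge_atTop (P * v + j + N + i + 1)))).exists
  have htl := hlarge t
  rw [show P * u + j + (v - u) * P = P * v + j by omega, ← ht1, ← ht2]
  obtain ⟨m, hm⟩ := Nat.exists_eq_add_of_le (show P * u ≤ t * P * p - i by omega)
  have hm' : P * v + m = t * P * p - i + (v - u) * P := by omega
  have hs : S.maxState M (P * u + m) (P * u) = S.maxState M (P * v + m) (P * v) := by
    rw [hm', hM.maxState_add_mul_period hP (by omega), ← hm, hstate u t (by omega),
      hstate v t (by omega)]
    exact hst
  rw [hm, hM.maxDigit_of_maxState_eq hs (by omega), hm', ← hm,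
    hM.maxDigit_add_mul_period hP (by omega)]

theorem HasAssociatedBase.isParry (hB : S.HasAssociatedBase B)
    (hS : S.numerationLanguage.IsRegular) : B.IsParry := by
  obtain ⟨Q, _, M, hM⟩ := exists_recognizes hS
  exact fun i _ => B.ultimatelyPeriodic_quasiGreedy (fun j hj =>
    hM.ultimatelyPeriodic_of_eventually_eq B.p_pos (hB.eventually_maxDigit_eq hj)) i

theorem exists_hasAssociatedBase (hS : S.numerationLanguage.IsRegular) :
    ∃ B : AlternateBase, S.HasAssociatedBase B := by
  obtain ⟨D, hD, h⟩ := exists_tendsto_ratio hS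
  choose y hy using h
  -- The denominator index `n D - i - 1` is congruent to `D - 1 - i` mod `D`.
  refine ⟨⟨D, hD, fun i => y (D - 1 - i), fun i => ?_⟩, fun i => ?_⟩
  · refine ge_of_tendsto' (hy _) fun n => ?_
    rw [le_div_iff₀ (by exact_mod_cast S.U_pos _), one_mul]
    exact_mod_cast S.increasing.monotone (Nat.le_succ _)
  · refine ((hy (D - 1 - i)).comp (tendsto_sub_atTop_nat 1)).congr' ?_
    filter_upwards [eventually_ge_atTop 1] with n hn
    obtain ⟨m, rfl⟩ := Nat.exists_eq_add_of_le' hn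
    have hi : (i : ℕ) < D := i.isLt
    have h1 : (m + 1) * D - i = D * m + (D - 1 - i) + 1 := by
      rw [Nat.succ_mul, mul_comm m]; omega
    simp only [Function.comp_apply, Nat.add_sub_cancel, h1]

theorem HasAssociatedBase.eq_of_p_eq {B B' : AlternateBase} (hB : S.HasAssociatedBase B)
    (hB' : S.HasAssociatedBase B') (h : B.p = B'.p) : B = B' := by
  obtain ⟨p, hp, β, hβ⟩ := B
  obtain ⟨p', hp', β', hβ'⟩ := B'
  obtain rfl : p = p' := h
  have : β = β' := funext fun i => tendsto_nhds_unique (hB i) (hB' i)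
  subst this
  rfl

end PositionalSystem

theorem mainTheorem6 (S : PositionalSystem) (hS : S.numerationLanguage.IsRegular) :
    ∃ B : AlternateBase, S.IsTheAssociatedBase B ∧
      (∀ B' : AlternateBase, S.IsTheAssociatedBase B' → B' = B) ∧ B.IsParry := by
  classical
  have hex : ∃ p, ∃ B : AlternateBase, S.HasAssociatedBase B ∧ B.p = p :=
    let ⟨B, hB⟩ := PositionalSystem.exists_hasAssociatedBase hS
    ⟨B.p, B, hB, rfl⟩
  obtain ⟨B, hB, hp⟩ := Nat.find_spec hex
  have hmin : ∀ B' : AlternateBase, S.HasAssociatedBase B' → B.p ≤ B'.p := fun B' hB' => by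
    rw [hp]
    exact Nat.find_min' hex ⟨B', hB', rfl⟩
  exact ⟨B, ⟨hB, hmin⟩, fun B' hB' =>
    hB'.1.eq_of_p_eq hB (le_antisymm (hB'.2 B hB) (hmin B' hB'.1)), hB.isParry hS⟩
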